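/- Let $(A,\mathfrak m)$ be a one-dimensional Cohen–Macaulay local ring with infinite residue field, let $xA$ be a minimal reduction of $\mathfrak m$, and let $r$ be its reduction number, i.e. the least integer $r\ge 0$ with $\mathfrak m^{r+1}=x\mathfrak m^r$. Let $\lambda$ denote length of $A$-modules, let $G(\mathfrak m)=\bigoplus_{n\ge 0}\mathfrak m^n/\mathfrak m^{n+1}$ be the tangent cone, and let $F(x)=\bigoplus_{n\ge 0}x^nA/x^n\mathfrak m$, which acts on $G(\mathfrak m)$ through the graded ring homomorphism induced by $xA\subseteq\mathfrak m$; let $x^\ast\in F(x)$ be the class of $x$ in $xA/x\mathfrak m$. There are integers $\alpha_i,\alpha_{i,j}\ge 0$ and an isomorphism of graded $F(x)$-modules $$G(\mathfrak m)\cong\bigoplus_{i=0}^{r}\bigl(F(x)(-i)\bigr)^{\alpha_i}\oplus\bigoplus_{i=1}^{r-1}\bigoplus_{j=1}^{r-i}\Bigl(\frac{F(x)}{(x^\ast)^jF(x)}(-i)\Bigr)^{\alpha_{i,j}}.$$ Let $\alpha_i,\alpha_{i,j}$ be any such integers (the invariants of the tangent cone). Let $A'$ be the first neighborhood ring of $A$,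 i.e. the subring of the total ring of fractions of $A$ consisting of the elements $b/a$ where, for some $s\ge 0$, $b\in\mathfrak m^s$ and $a$ is a superficial element of degree $s$ (a regular element $a\in\mathfrak m^s$ with $\mathfrak m^{n+s}=a\mathfrak m^n$ for all large $n$). For $1\le i\le r$ define the micro-invariants $$\beta_i=\lambda\left(\frac{A+\mathfrak m^{i-1}A'}{A+\mathfrak m^{i}A'}\right)-\lambda\left(\frac{A+\mathfrak m^{i}A'}{A+\mathfrak m^{i+1}A'}\right)$$ and the Apery invariants with respect to $x$ $$\gamma_i=\lambda\left(\frac{\mathfrak m^i+xA}{\mathfrak m^{i+1}+xA}\right).$$ Then $$\sum_{i=1}^r i\gamma_i\le\sum_{i=1}^r i\beta_i\le\sum_{i=1}^r i\alpha_i ,$$ and each of the three equalities $\sum i\gamma_i=\sum i\beta_i$, $\sum i\beta_i=\sum i\alpha_i$, $\sum i\gamma_i=\sum i\alpha_i$ holds if and only if $G(\mathfrak m)$ is a Cohen–Macaulay ring. -/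

import Mathlib

open IsLocalRing Polynomial
open scoped nonZeroDivisors

noncomputable section

namespace TangentCone

universe u

/-! ### Cohen–Macaulay rings -/

/-- A local ring is Cohen–Macaulay if it is Noetherian and its depth equals its Krull dimension:
some regular sequence contained in the maximal ideal has length `dim R`. -/
def IsCohenMacaulayLocalRing (R : Type u) [CommRing R] [IsLocalRing R] : Prop :=
  IsNoetherianRing R ∧
    ∃ rs : List R, (∀ a ∈ rs, a ∈ maximalIdeal R) ∧ RingTheory.Sequence.IsRegular R rs ∧
      (rs.length : WithBot ℕ∞) = ringKrullDim R

/-- A ring is Cohen–Macaulay if it is Noetherian and its localizations at all maximal ideals are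
Cohen–Macaulay local rings. -/
def IsCohenMacaulayRing (R : Type u) [CommRing R] : Prop :=
  IsNoetherianRing R ∧
    ∀ (p : Ideal R) [p.IsMaximal], IsCohenMacaulayLocalRing (Localization.AtPrime p)

/-! ### Lengths and reductions -/

/-- The length of `P / N`, for submodules `N ≤ P` of an `R`-module such that `P / N` has finite
length. -/
def relLength {R M : Type*} [CommRing R] [AddCommGroup M] [Module R M] (P N : Submodule R M) : ℕ :=
  (Module.length R (P ⧸ N.submoduleOf P)).toNat

/-- `J` is a reduction of `I`: `J ⊆ I` and `I ^ (n + 1) = J I ^ n` for some `n`. -/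
def IsReduction {A : Type u} [CommRing A] (J I : Ideal A) : Prop :=
  J ≤ I ∧ ∃ n : ℕ, I ^ (n + 1) = J * I ^ n

/-- `J` is a minimal reduction of `I`: minimal for inclusion among the reductions of `I`. -/
def IsMinimalReduction {A : Type u} [CommRing A] (J I : Ideal A) : Prop :=
  Minimal (fun J' : Ideal A => IsReduction J' I) J

/-- The least `n` with `I ^ (n + 1) = J I ^ n`, for a reduction `J` of `I`. -/
def reductionNumber {A : Type u} [CommRing A] (J I : Ideal A) : ℕ :=
  sInf {n : ℕ | I ^ (n + 1) = J * I ^ n}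

/-- The sum `∑_{i=1}^{r} i c_i`. -/
def weightedSum (r : ℕ) (c : ℕ → ℤ) : ℤ :=
  ∑ i ∈ Finset.Icc 1 r, (i : ℤ) * c i

section LocalRing

variable {A : Type u} [CommRing A] [IsLocalRing A]

/-! ### The tangent cone and the Noether normalization `F(x)` -/

/-- The standard graded ring `⨁ₙ I ^ n / 𝔪 I ^ n`, as the quotient of the Rees algebra
`⨁ₙ I ^ n tⁿ` of `I` by the ideal `⨁ₙ 𝔪 I ^ n tⁿ` generated by `𝔪`. -/
def FiberCone (I : Ideal A) : Type u :=
  reesAlgebra I ⧸ (maximalIdeal A).map (algebraMap A (reesAlgebra I))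

instance (I : Ideal A) : CommRing (FiberCone I) :=
  inferInstanceAs
    (CommRing (reesAlgebra I ⧸ (maximalIdeal A).map (algebraMap A (reesAlgebra I))))

instance (I : Ideal A) : Algebra A (FiberCone I) :=
  inferInstanceAs
    (Algebra A (reesAlgebra I ⧸ (maximalIdeal A).map (algebraMap A (reesAlgebra I))))

/-- The tangent cone `G(𝔪) = ⨁ₙ 𝔪 ^ n / 𝔪 ^ (n + 1)` of a local ring. -/
abbrev Cone (A : Type u) [CommRing A] [IsLocalRing A] : Type u :=
  FiberCone (maximalIdeal A)

/-- The map sending `c ∈ I ^ n` to its class in `I ^ n / 𝔪 I ^ n`, placed in degree `n`. -/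
def FiberCone.of (I : Ideal A) (n : ℕ) : ↥(I ^ n) →ₗ[A] FiberCone I :=
  (Ideal.Quotient.mkₐ A ((maximalIdeal A).map (algebraMap A (reesAlgebra I)))).toLinearMap ∘ₗ
    LinearMap.codRestrict (Subalgebra.toSubmodule (reesAlgebra I))
      ((Polynomial.monomial n : A →ₗ[A] A[X]) ∘ₗ (I ^ n).subtype)
      (fun c => reesAlgebra.monomial_mem.mpr c.2)

/-- The homogeneous component of degree `n`, that is `I ^ n / 𝔪 I ^ n`. -/
def FiberCone.piece (I : Ideal A) (n : ℕ) : Submodule A (FiberCone I) :=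
  LinearMap.range (FiberCone.of I n)

/-- The elements in the ideal of the Rees algebra generated by `𝔪` are those whose coefficient
in each degree `n` lies in `𝔪 I ^ n`. -/
theorem mem_map_maximalIdeal_iff (I : Ideal A) (f : reesAlgebra I) :
    f ∈ (maximalIdeal A).map (algebraMap A (reesAlgebra I)) ↔
      ∀ n, (f : A[X]).coeff n ∈ maximalIdeal A * I ^ n := by
  constructor
  · intro hf
    refine Submodule.span_induction ?_ ?_ ?_ ?_ hf
    · rintro _ ⟨a, ha, rfl⟩ n
      change (algebraMap A A[X] a).coeff n ∈ _
      rw [Polynomial.algebraMap_apply, Algebra.algebraMap_self, RingHom.id_apply, coeff_C]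
      split_ifs with h
      · subst h
        simpa using ha
      · exact Ideal.zero_mem _
    · intro n
      simp
    · intro p q _ _ hp hq n
      simpa using Ideal.add_mem _ (hp n) (hq n)
    · intro a p _ hp n
      change ((a : A[X]) * (p : A[X])).coeff n ∈ _
      rw [coeff_mul]
      refine Ideal.sum_mem _ ?_
      rintro ⟨j, k⟩ e
      rw [← Finset.HasAntidiagonal.mem_antidiagonal.mp e, pow_add, mul_left_comm]
      exact Ideal.mul_mem_mul (a.2 j) (hp k)
  · intro hf
    have key : ∀ (n : ℕ) (c : A), c ∈ maximalIdeal A * I ^ n →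
        ∃ y ∈ (maximalIdeal A).map (algebraMap A (reesAlgebra I)),
          (y : A[X]) = Polynomial.monomial n c := by
      intro n c hc
      refine Submodule.mul_induction_on hc ?_ ?_
      · intro a ha b hb
        refine ⟨(⟨Polynomial.monomial n b, reesAlgebra.monomial_mem.mpr hb⟩ : reesAlgebra I) *
              algebraMap A (reesAlgebra I) a,
          Ideal.mul_mem_left _ _ (Ideal.mem_map_of_mem _ ha), ?_⟩
        change Polynomial.monomial n b * C a = _
        rw [monomial_mul_C, mul_comm]
      · rintro a b ⟨y, hy, hya⟩ ⟨z, hz, hzb⟩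
        exact ⟨y + z, Ideal.add_mem _ hy hz, by rw [map_add, ← hya, ← hzb]; rfl⟩
    choose! y hy hy' using key
    have : f = ∑ i ∈ (f : A[X]).support, y i ((f : A[X]).coeff i) := by
      apply Subtype.ext
      rw [AddSubmonoidClass.coe_finsetSum, Finset.sum_congr rfl fun i _ => hy' i _ (hf i)]
      exact (f : A[X]).as_sum_support
    rw [this]
    exact Ideal.sum_mem _ fun i _ => hy i _ (hf i)

/-- The degree `n` component is `I ^ n / 𝔪 I ^ n`. -/
theorem FiberCone.of_eq_zero_iff (I : Ideal A) (n : ℕ) (c : ↥(I ^ n)) :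
    FiberCone.of I n c = 0 ↔ (c : A) ∈ maximalIdeal A * I ^ n := by
  change Ideal.Quotient.mk _ (⟨Polynomial.monomial n (c : A), _⟩ : reesAlgebra I) = 0 ↔ _
  rw [Ideal.Quotient.eq_zero_iff_mem, mem_map_maximalIdeal_iff]
  constructor
  · intro h
    simpa using h n
  · intro h m
    change (Polynomial.monomial n (c : A)).coeff m ∈ _
    rw [coeff_monomial]
    split_ifs with e
    · exact e ▸ h
    · exact Ideal.zero_mem _

/-- The homogeneous component of degree `n` of the shifted module `FiberCone I (-i)`. -/
def FiberCone.shiftedPiece (I : Ideal A) (i n : ℕ) : Submodule A (FiberCone I) :=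
  if i ≤ n then FiberCone.piece I (n - i) else ⊥

/-- For `I ≤ J`, the Rees algebra of `I` is contained in that of `J`. -/
theorem reesAlgebra_le {R : Type u} [CommRing R] {I J : Ideal R} (h : I ≤ J) : reesAlgebra I ≤ reesAlgebra J :=
  fun _ hf i => Ideal.pow_right_mono h i (hf i)

/-- The graded ring homomorphism `⨁ₙ I ^ n / 𝔪 I ^ n → ⨁ₙ J ^ n / 𝔪 J ^ n` induced by `I ≤ J`. -/
def FiberCone.map {I J : Ideal A} (h : I ≤ J) : FiberCone I →+* FiberCone J :=
  Ideal.quotientMap _ (Subalgebra.inclusion (reesAlgebra_le h)).toRingHom (by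
    rw [Ideal.map_le_iff_le_comap]
    intro a ha
    exact Ideal.mem_map_of_mem (algebraMap A (reesAlgebra J)) ha)

/-- The ring `F(x) = ⨁ₙ xⁿA / xⁿ𝔪`. -/
abbrev NoetherNormalization (x : A) : Type u :=
  FiberCone (Ideal.span {x})

/-- The element `x⋆` of `F(x)`: the class of `x` in `xA / x𝔪`, in degree one. -/
def xStar (x : A) : NoetherNormalization x :=
  FiberCone.of (Ideal.span {x}) 1
    ⟨x, by rw [pow_one]; exact Ideal.mem_span_singleton_self x⟩

/-- The indices `(i, j)` with `1 ≤ i ≤ r - 1` and `1 ≤ j ≤ r - i`. -/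
abbrev TorsionIndex (r : ℕ) : Type :=
  {p : ℕ × ℕ // 1 ≤ p.1 ∧ 1 ≤ p.2 ∧ p.1 + p.2 ≤ r}

/-- The `F(x)`-module
`⨁_{i=0}^{r} F(x)(-i)^{α i} ⊕ ⨁_{i=1}^{r-1} ⨁_{j=1}^{r-i} (F(x) / x⋆ʲ F(x))(-i)^{τ i j}`,
without its grading (the index sets being finite, direct sums are products). -/
abbrev DecompositionModule (x : A) (r : ℕ) (α : ℕ → ℕ) (τ : ℕ → ℕ → ℕ) : Type u :=
  ((Σ i : Fin (r + 1), Fin (α i)) → NoetherNormalization x) ×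
    ((s : Σ p : TorsionIndex r, Fin (τ p.1.1 p.1.2)) →
      NoetherNormalization x ⧸ Ideal.span {xStar x ^ s.1.1.2})

/-- Membership in the homogeneous component of degree `n` of the graded module
`⨁_{i=0}^{r} F(x)(-i)^{α i} ⊕ ⨁_{i=1}^{r-1} ⨁_{j=1}^{r-i} (F(x) / x⋆ʲ F(x))(-i)^{τ i j}`. -/
def IsHomogeneousOfDegree {x : A} {r : ℕ} {α : ℕ → ℕ} {τ : ℕ → ℕ → ℕ} (n : ℕ)
    (d : DecompositionModule x r α τ) : Prop :=
  (∀ s, d.1 s ∈ FiberCone.shiftedPiece (Ideal.span {x}) s.1 n) ∧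
    ∀ s, ∃ f ∈ FiberCone.shiftedPiece (Ideal.span {x}) s.1.1.1 n,
      d.2 s = Ideal.Quotient.mk _ f

/-- The numbers `α i` and `τ i j` are invariants of the tangent cone with respect to `x`: there is
an isomorphism of graded `F(x)`-modules
`G(𝔪) ≅ ⨁_{i=0}^{r} F(x)(-i)^{α i} ⊕ ⨁_{i=1}^{r-1} ⨁_{j=1}^{r-i} (F(x) / x⋆ʲ F(x))(-i)^{τ i j}`,
where `r` is the reduction number and `F(x)` acts on `G(𝔪)` through the ring homomorphism
`F(x) → G(𝔪)` induced by `xA ⊆ 𝔪`. -/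
def IsTangentConeInvariants (x : A) (hx : Ideal.span {x} ≤ maximalIdeal A)
    (α : ℕ → ℕ) (τ : ℕ → ℕ → ℕ) : Prop :=
  ∃ e : Cone A ≃+
      DecompositionModule x (reductionNumber (Ideal.span {x}) (maximalIdeal A)) α τ,
    (∀ (f : NoetherNormalization x) (g : Cone A), e (FiberCone.map hx f * g) = f • e g) ∧
      ∀ (n : ℕ) (g : Cone A),
        g ∈ FiberCone.piece (maximalIdeal A) n ↔ IsHomogeneousOfDegree n (e g)

/-! ### The first neighborhood ring and the micro-invariants -/

/-- `a` is superficial of degree `s`: `a ∈ 𝔪 ^ s` and `𝔪 ^ (n + s) = a 𝔪 ^ n` for all large `n`. -/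
def IsSuperficial (s : ℕ) (a : A) : Prop :=
  a ∈ maximalIdeal A ^ s ∧
    ∃ N : ℕ, ∀ n ≥ N, maximalIdeal A ^ (n + s) = Ideal.span {a} * maximalIdeal A ^ n

theorem IsSuperficial.mul {s t : ℕ} {a b : A} (ha : IsSuperficial s a) (hb : IsSuperficial t b) :
    IsSuperficial (s + t) (a * b) := by
  obtain ⟨ha, N, hN⟩ := ha
  obtain ⟨hb, M, hM⟩ := hb
  refine ⟨pow_add (maximalIdeal A) s t ▸ Ideal.mul_mem_mul ha hb, max N M, fun n hn => ?_⟩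
  have h1 := hN (n + t) (by omega)
  have h2 := hM n (by omega)
  rw [show n + (s + t) = n + t + s by omega, h1, h2, ← mul_assoc,
    Ideal.span_singleton_mul_span_singleton]

/-- The element `1` is superficial of degree `0`. -/
theorem isSuperficial_one : IsSuperficial 0 (1 : A) :=
  ⟨by simp, 0, fun n _ => by simp⟩

variable (A) in
/-- The first neighborhood ring `A'` of `A`: the elements `b / a` of the total ring of fractions
of `A`, where `a` is a (regular) superficial element of some degree `s` and `b ∈ 𝔪 ^ s`. -/
def firstNeighborhoodRing : Subalgebra A (FractionRing A) where
  carrier := {q | ∃ (s : ℕ) (a : A⁰) (b : A), IsSuperficial s (a : A) ∧ b ∈ maximalIdeal A ^ s ∧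
    q = IsLocalization.mk' (FractionRing A) b a}
  mul_mem' := by
    rintro _ _ ⟨s, a, b, ha, hb, rfl⟩ ⟨t, c, d, hc, hd, rfl⟩
    exact ⟨s + t, a * c, b * d, ha.mul hc,
      pow_add (maximalIdeal A) s t ▸ Ideal.mul_mem_mul hb hd, (IsLocalization.mk'_mul _ _ _ _ _).symm⟩
  add_mem' := by
    rintro _ _ ⟨s, a, b, ha, hb, rfl⟩ ⟨t, c, d, hc, hd, rfl⟩
    refine ⟨s + t, a * c, b * c + d * a, ha.mul hc, ?_, (IsLocalization.mk'_add _ _ _ _).symm⟩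
    rw [pow_add]
    refine Ideal.add_mem _ (Ideal.mul_mem_mul hb hc.1) ?_
    rw [mul_comm d]
    exact Ideal.mul_mem_mul ha.1 hd
  algebraMap_mem' c :=
    ⟨0, 1, c, isSuperficial_one, by simp, (IsLocalization.mk'_one _ _).symm⟩

variable (A) in
/-- The `A`-submodule `A + 𝔪 ^ i A'` of the total ring of fractions. -/
def neighborhoodFiltration (i : ℕ) : Submodule A (FractionRing A) :=
  1 ⊔ (maximalIdeal A) ^ i • Subalgebra.toSubmodule (firstNeighborhoodRing A)

variable (A) in
/-- The micro-invariant
`β i = λ((A + 𝔪 ^ (i-1) A') / (A + 𝔪 ^ i A')) - λ((A + 𝔪 ^ i A') / (A + 𝔪 ^ (i+1) A'))`, `i ≥ 1`. -/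
def microInvariant (i : ℕ) : ℤ :=
  (relLength (neighborhoodFiltration A (i - 1)) (neighborhoodFiltration A i) : ℤ) -
    relLength (neighborhoodFiltration A i) (neighborhoodFiltration A (i + 1))

/-! ### The Apery invariants -/

/-- The Apery invariant `γ i = λ((𝔪 ^ i + xA) / (𝔪 ^ (i+1) + xA))` of `A` with respect to `x`. -/
def aperyInvariant (x : A) (i : ℕ) : ℕ :=
  relLength (maximalIdeal A ^ i ⊔ Ideal.span {x}) (maximalIdeal A ^ (i + 1) ⊔ Ideal.span {x})

end LocalRing

end TangentCone

end

/-! All three sums are compared with the single length `λ(𝔪 ^ r / x ^ r A)`. The ring has depth one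
and `𝔪 ^ (r + 1) ⊆ xA`, so `x` is regular.

Micro-invariants: summation by parts turns `∑ i β i` into `λ(A' / A)`, because `A + 𝔪 ^ r A' = A`.
Multiplication by `x ^ r` carries `A'` onto `𝔪 ^ r` and `A` onto `x ^ r A`, so the sum equals the
reference length (`weightedSum_microInvariant`).

Apery invariants: summation by parts gives `∑_{i<r} λ(𝔪 ^ (i+1) / (𝔪 ^ (i+1) ∩ xA))`, while the
reference length is `∑_{i<r} λ(𝔪 ^ (i+1) / x 𝔪 ^ i)`. Since `x 𝔪 ^ i ⊆ 𝔪 ^ (i+1) ∩ xA`, the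
inequality follows, with equality exactly when these ideals agree for all `i`, that is, when the
initial form of `x` is regular on the tangent cone (`weightedSum_aperyInvariant_eq_iff`,
`isRegular_xStar_iff`).

Tangent cone: let `H` be its Hilbert function. The reference length is `r H(r) - ∑_{n<r} H(n)`.
Reading `H` off a decomposition, a free summand born in degree `i` contributes `i` to this
difference and a torsion summand of length `j` contributes `-j`. Hence `∑ i α i` is the reference
length plus the total length of the torsion (`weightedSum_eq_of_decomposition`), with equality
exactly when there is no torsion, which is again regularity of the initial form.

That regularity is equivalent to Cohen–Macaulayness (`isCohenMacaulayRing_iff`): one direction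
localizes at the irrelevant ideal, the other uses that the cone is finite and torsion-free over
`k[T]`. A decomposition exists because the cone is a persistence module that is constant from degree
`r` on (`exists_barcode`, `exists_decomposition`). -/

noncomputable section

namespace TangentCone

universe u

/-! ### The grading of the fiber cone. -/

namespace FiberCone

variable {A : Type u} [CommRing A] [IsLocalRing A] {I J : Ideal A}

/-- The quotient map from the Rees algebra. -/
def mk (I : Ideal A) : reesAlgebra I →ₐ[A] FiberCone I :=
  Ideal.Quotient.mkₐ A _

theorem mk_surjective : Function.Surjective (mk I) :=
  Ideal.Quotient.mkₐ_surjective A _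

theorem mk_eq_zero_iff (f : reesAlgebra I) :
    mk I f = 0 ↔ ∀ n, (f : A[X]).coeff n ∈ maximalIdeal A * I ^ n := by
  rw [← mem_map_maximalIdeal_iff]
  exact Ideal.Quotient.eq_zero_iff_mem

theorem of_eq_mk (n : ℕ) (c : ↥(I ^ n)) :
    of I n c = mk I ⟨monomial n (c : A), reesAlgebra.monomial_mem.mpr c.2⟩ := rfl

theorem of_congr {m n : ℕ} (h : m = n) {c : ↥(I ^ m)} {d : ↥(I ^ n)} (hcd : (c : A) = d) :
    of I m c = of I n d := by
  subst h
  rw [Subtype.ext hcd]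

theorem of_mul_of (m n : ℕ) (c : ↥(I ^ m)) (d : ↥(I ^ n)) :
    of I m c * of I n d =
      of I (m + n) ⟨c * d, pow_add I m n ▸ Ideal.mul_mem_mul c.2 d.2⟩ := by
  rw [of_eq_mk, of_eq_mk, of_eq_mk, ← map_mul]
  congr 1
  exact Subtype.ext (monomial_mul_monomial m n (c : A) d)

theorem algebraMap_eq_of (a : A) :
    algebraMap A (FiberCone I) a = of I 0 ⟨a, by simp⟩ := by
  rw [of_eq_mk, ← AlgHom.commutes (mk I)]
  rfl

theorem one_eq_of : (1 : FiberCone I) = of I 0 ⟨1, by simp⟩ := by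
  rw [← algebraMap_eq_of, map_one]

theorem of_pow (n m : ℕ) (c : ↥(I ^ n)) :
    of I n c ^ m = of I (n * m) ⟨c ^ m, pow_mul I n m ▸ Ideal.pow_mem_pow c.2 m⟩ := by
  induction m with
  | zero => rw [pow_zero, one_eq_of]; exact of_congr (by simp) (by simp)
  | succ m ih => rw [pow_succ, ih, of_mul_of]; exact of_congr (by ring) (by simp [pow_succ])

theorem of_mem_piece (n : ℕ) (c : ↥(I ^ n)) : of I n c ∈ piece I n := ⟨c, rfl⟩

theorem mul_mem_piece {m n : ℕ} {f g : FiberCone I} (hf : f ∈ piece I m) (hg : g ∈ piece I n) :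
    f * g ∈ piece I (m + n) := by
  obtain ⟨c, rfl⟩ := hf
  obtain ⟨d, rfl⟩ := hg
  rw [of_mul_of]
  exact of_mem_piece _ _

theorem smul_eq_zero_of_mem {a : A} (ha : a ∈ maximalIdeal A) (g : FiberCone I) : a • g = 0 := by
  obtain ⟨f, rfl⟩ := mk_surjective g
  rw [← map_smul, mk_eq_zero_iff]
  intro n
  simpa using Ideal.mul_mem_mul ha (f.2 n)

/-- The projection of the fiber cone onto its homogeneous component of degree `n`. -/
def proj (I : Ideal A) (n : ℕ) : FiberCone I →ₗ[A] FiberCone I :=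
  let φ : reesAlgebra I →ₗ[A] FiberCone I :=
    of I n ∘ₗ LinearMap.codRestrict (I ^ n)
      (Polynomial.lcoeff A n ∘ₗ (Subalgebra.toSubmodule (reesAlgebra I)).subtype) (fun f => f.2 n)
  -- The projection is computed on an arbitrary preimage chosen by `surjInv`; independence of that
  -- choice is what makes it linear.
  have hφ : ∀ f g, mk I f = mk I g → φ f = φ g := fun f g h => by
    rw [← sub_eq_zero, ← map_sub] at h ⊢
    exact (of_eq_zero_iff I n _).mpr ((mk_eq_zero_iff _).mp h n)
  { toFun := fun g => φ (Function.surjInv mk_surjective g)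
    map_add' := fun g h => by
      rw [← map_add]
      apply hφ
      simp only [map_add, Function.surjInv_eq]
    map_smul' := fun a g => by
      rw [RingHom.id_apply, ← map_smul]
      apply hφ
      simp only [map_smul, Function.surjInv_eq] }

theorem proj_mk (n : ℕ) (f : reesAlgebra I) :
    proj I n (mk I f) = of I n ⟨(f : A[X]).coeff n, f.2 n⟩ := by
  have h : mk I (Function.surjInv mk_surjective (mk I f)) = mk I f := Function.surjInv_eq _ _
  rw [← sub_eq_zero, ← map_sub] at h
  refine sub_eq_zero.mp ?_
  change of I n _ - _ = _
  rw [← map_sub, of_eq_zero_iff]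
  have := (mk_eq_zero_iff _).mp h n
  rw [AddSubgroupClass.coe_sub, coeff_sub] at this
  exact this

theorem proj_mem (n : ℕ) (g : FiberCone I) : proj I n g ∈ piece I n := by
  obtain ⟨f, rfl⟩ := mk_surjective g
  rw [proj_mk]
  exact of_mem_piece _ _

theorem proj_of (m n : ℕ) (c : ↥(I ^ n)) :
    proj I m (of I n c) = if m = n then of I n c else 0 := by
  rw [of_eq_mk, proj_mk]
  split_ifs with h
  · subst h
    exact congrArg _ (Subtype.ext (coeff_monomial_same m (c : A)))
  · rw [of_eq_zero_iff]
    change (monomial n (c : A)).coeff m ∈ _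
    rw [coeff_monomial_of_ne _ h]
    exact Ideal.zero_mem _

theorem proj_of_mem {n : ℕ} {g : FiberCone I} (hg : g ∈ piece I n) (m : ℕ) :
    proj I m g = if m = n then g else 0 := by
  obtain ⟨c, rfl⟩ := hg
  exact proj_of m n c

theorem exists_sum_proj (g : FiberCone I) :
    ∃ N : ℕ, g = ∑ n ∈ Finset.range N, proj I n g := by
  obtain ⟨f, rfl⟩ := mk_surjective g
  refine ⟨(f : A[X]).natDegree + 1, ?_⟩
  simp_rw [proj_mk, of_eq_mk]
  rw [← map_sum]
  congr 1
  apply Subtype.ext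
  rw [AddSubmonoidClass.coe_finsetSum]
  exact (f : A[X]).as_sum_range

theorem eq_zero_of_proj {g : FiberCone I} (h : ∀ n, proj I n g = 0) : g = 0 := by
  obtain ⟨N, hN⟩ := exists_sum_proj g
  rw [hN]
  exact Finset.sum_eq_zero fun n _ => h n

theorem mem_piece_iff_proj {n : ℕ} {g : FiberCone I} : g ∈ piece I n ↔ proj I n g = g :=
  ⟨fun h => by rw [proj_of_mem h, if_pos rfl], fun h => h ▸ proj_mem n g⟩

/-- Multiplication by a homogeneous element shifts degrees. This is the tool by which identities in
the cone are checked one degree at a time. -/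
theorem proj_mul_of_mem {b : ℕ} {u : FiberCone I} (hu : u ∈ piece I b) (p : FiberCone I) (n : ℕ) :
    proj I n (p * u) = if b ≤ n then proj I (n - b) p * u else 0 := by
  obtain ⟨N, hN⟩ := exists_sum_proj p
  have key : ∀ m, proj I n (proj I m p * u) = if m + b = n then proj I m p * u else 0 := fun m => by
    rw [proj_of_mem (mul_mem_piece (proj_mem m p) hu)]
    exact if_congr eq_comm rfl rfl
  have hproj : ∀ q, proj I q p = ∑ m ∈ Finset.range N, if m = q then proj I m p else 0 := by
    intro q
    conv_lhs => rw [hN]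
    rw [map_sum]
    refine Finset.sum_congr rfl fun m _ => ?_
    rw [proj_of_mem (proj_mem m p)]
    exact if_congr eq_comm rfl rfl
  conv_lhs => rw [hN]
  rw [Finset.sum_mul, map_sum, Finset.sum_congr rfl fun m _ => key m]
  split_ifs with h
  · rw [hproj, Finset.sum_mul]
    refine Finset.sum_congr rfl fun m _ => ?_
    rw [ite_mul, zero_mul]
    exact if_congr (by omega) rfl rfl
  · exact Finset.sum_eq_zero fun m _ => if_neg (by omega)

theorem map_mk (h : I ≤ J) (f : reesAlgebra I) :
    map h (mk I f) = mk J (Subalgebra.inclusion (reesAlgebra_le h) f) := rfl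

theorem map_of (h : I ≤ J) (n : ℕ) (c : ↥(I ^ n)) :
    map h (of I n c) = of J n ⟨c, Ideal.pow_right_mono h n c.2⟩ := rfl

theorem map_algebraMap (h : I ≤ J) (a : A) :
    map h (algebraMap A (FiberCone I) a) = algebraMap A (FiberCone J) a := by
  rw [algebraMap_eq_of, algebraMap_eq_of, map_of]

theorem map_smul_base (h : I ≤ J) (a : A) (f : FiberCone I) : map h (a • f) = a • map h f := by
  rw [Algebra.smul_def, Algebra.smul_def, map_mul, map_algebraMap]

theorem proj_map (h : I ≤ J) (n : ℕ) (f : FiberCone I) :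
    proj J n (map h f) = map h (proj I n f) := by
  obtain ⟨f, rfl⟩ := mk_surjective f
  rw [map_mk, proj_mk, proj_mk, map_of]
  rfl

theorem map_mem_piece (h : I ≤ J) {n : ℕ} {f : FiberCone I} (hf : f ∈ piece I n) :
    map h f ∈ piece J n := by
  obtain ⟨c, rfl⟩ := hf
  exact of_mem_piece (I := J) n ⟨c, Ideal.pow_right_mono h n c.2⟩

/-- The fiber cone is an algebra over the residue field. -/
instance : Algebra (ResidueField A) (FiberCone I) :=
  (Ideal.Quotient.lift (maximalIdeal A) (algebraMap A (FiberCone I)) fun a ha => by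
    rw [Algebra.algebraMap_eq_smul_one]
    exact smul_eq_zero_of_mem ha 1).toAlgebra

instance : IsScalarTower A (ResidueField A) (FiberCone I) :=
  IsScalarTower.of_algebraMap_eq fun _ => rfl

theorem residue_smul (a : A) (g : FiberCone I) : residue A a • g = a • g :=
  algebraMap_smul (ResidueField A) a g


end FiberCone

end TangentCone

end

/-! ### Additivity of length and summation by parts. -/

noncomputable section

namespace TangentCone

universe u

section Length

variable {R M M' : Type*} [CommRing R] [AddCommGroup M] [Module R M] [AddCommGroup M'] [Module R M']

/-- The length of `P / N`, possibly infinite. -/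
def eRelLength (P N : Submodule R M) : ℕ∞ :=
  Module.length R (P ⧸ N.submoduleOf P)

theorem relLength_eq_toNat (P N : Submodule R M) : relLength P N = (eRelLength P N).toNat := rfl

theorem eRelLength_add {N P Q : Submodule R M} (hNP : N ≤ P) (hPQ : P ≤ Q) :
    eRelLength Q N = eRelLength P N + eRelLength Q P := by
  have hf : N.submoduleOf P ≤ (N.submoduleOf Q).comap (Submodule.inclusion hPQ) := fun _ h => h
  have hg : N.submoduleOf Q ≤ (P.submoduleOf Q).comap LinearMap.id := fun _ h => hNP h
  refine Module.length_eq_add_of_exact (Submodule.mapQ _ _ (Submodule.inclusion hPQ) hf)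
    (Submodule.mapQ _ _ LinearMap.id hg) ?_ ?_ ?_
  · rw [← LinearMap.ker_eq_bot, LinearMap.ker_eq_bot']
    intro y hy
    obtain ⟨y, rfl⟩ := Submodule.Quotient.mk_surjective _ y
    rw [Submodule.mapQ_apply, Submodule.Quotient.mk_eq_zero] at hy
    exact (Submodule.Quotient.mk_eq_zero _).mpr hy
  · intro y
    obtain ⟨y, rfl⟩ := Submodule.Quotient.mk_surjective _ y
    exact ⟨Submodule.Quotient.mk y, rfl⟩
  · intro y
    obtain ⟨y, rfl⟩ := Submodule.Quotient.mk_surjective _ y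
    rw [Submodule.mapQ_apply, Submodule.Quotient.mk_eq_zero]
    constructor
    · intro h
      exact ⟨Submodule.Quotient.mk ⟨y, h⟩, rfl⟩
    · rintro ⟨z, hz⟩
      obtain ⟨z, rfl⟩ := Submodule.Quotient.mk_surjective _ z
      rw [Submodule.mapQ_apply, Submodule.Quotient.eq] at hz
      have h1 : ((z : M) - y) ∈ N := hz
      change (y : M) ∈ P
      have := P.sub_mem z.2 (hNP h1)
      rwa [sub_sub_cancel] at this

theorem eRelLength_sup (P N : Submodule R M) :
    eRelLength (P ⊔ N) N = eRelLength P (P ⊓ N) :=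
  (LinearMap.quotientInfEquivSupQuotient P N).length_eq.symm

theorem eRelLength_map {f : M →ₗ[R] M'} (hf : Function.Injective f) (P N : Submodule R M) :
    eRelLength (P.map f) (N.map f) = eRelLength P N := by
  refine (Submodule.Quotient.equiv _ _ (Submodule.equivMapOfInjective f hf P) ?_).length_eq.symm
  ext ⟨y, hy⟩
  obtain ⟨z, hz, rfl⟩ := hy
  constructor
  · rintro ⟨w, hw, h⟩
    have : f w = f z := congrArg Subtype.val h
    exact ⟨w, hw, this⟩
  · rintro ⟨w, hw, h⟩
    obtain rfl := hf h
    exact ⟨⟨w, hz⟩, hw, rfl⟩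

theorem eRelLength_eq_zero_iff {P N : Submodule R M} : eRelLength P N = 0 ↔ P ≤ N := by
  rw [eRelLength, Module.length_eq_zero_iff, Submodule.Quotient.subsingleton_iff,
    Submodule.submoduleOf_eq_top]

/-- Finiteness is essential: `relLength` sends infinite length to `0`, so additivity fails without
it. -/
theorem relLength_add {N P Q : Submodule R M} (hNP : N ≤ P) (hPQ : P ≤ Q)
    (h : eRelLength Q N ≠ ⊤) : relLength Q N = relLength P N + relLength Q P := by
  rw [eRelLength_add hNP hPQ, ne_eq, ENat.add_eq_top, not_or] at h
  rw [relLength_eq_toNat, eRelLength_add hNP hPQ, ENat.toNat_add h.1 h.2]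
  rfl

theorem relLength_sup (P N : Submodule R M) : relLength (P ⊔ N) N = relLength P (P ⊓ N) :=
  congrArg ENat.toNat (eRelLength_sup P N)

theorem relLength_map {f : M →ₗ[R] M'} (hf : Function.Injective f) (P N : Submodule R M) :
    relLength (P.map f) (N.map f) = relLength P N :=
  congrArg ENat.toNat (eRelLength_map hf P N)

theorem relLength_eq_zero_iff {P N : Submodule R M} (h : eRelLength P N ≠ ⊤) :
    relLength P N = 0 ↔ P ≤ N := by
  rw [relLength_eq_toNat, ENat.toNat_eq_zero, or_iff_left h, eRelLength_eq_zero_iff]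

theorem sum_relLength_of_antitone {N : ℕ → Submodule R M} (hN : Antitone N) (m : ℕ)
    (h : eRelLength (N 0) (N m) ≠ ⊤) :
    ∑ i ∈ Finset.range m, relLength (N i) (N (i + 1)) = relLength (N 0) (N m) := by
  induction m with
  | zero =>
    rw [Finset.sum_range_zero, eq_comm, relLength_eq_zero_iff h]
  | succ m ih =>
    have h' := h
    rw [eRelLength_add (hN m.le_succ) (hN m.zero_le), ne_eq, ENat.add_eq_top, not_or] at h'
    rw [Finset.sum_range_succ, ih h'.2, relLength_add (hN m.le_succ) (hN m.zero_le) h, add_comm]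

end Length

section WeightedSum

/-- Summation by parts. It is applied to sequences `L` with `L m = 0`, where the weighted sum of the
differences becomes the plain sum of `L`. -/
theorem weightedSum_eq_sum_sub {c L : ℕ → ℤ} (h : ∀ i, c (i + 1) = L i - L (i + 1)) (m : ℕ) :
    weightedSum m c = ∑ i ∈ Finset.range m, L i - m * L m := by
  induction m with
  | zero => simp [weightedSum]
  | succ m ih =>
    rw [weightedSum] at ih ⊢
    rw [Finset.sum_Icc_succ_top (by omega), ih, Finset.sum_range_succ, h]
    push_cast
    ring

theorem weightedSum_natCast (m : ℕ) (c : ℕ → ℕ) :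
    weightedSum m (fun i => (c i : ℤ)) = ((∑ i ∈ Finset.range (m + 1), c i * i : ℕ) : ℤ) := by
  induction m with
  | zero => simp [weightedSum]
  | succ m ih =>
    rw [weightedSum] at ih ⊢
    rw [Finset.sum_Icc_succ_top (by omega), ih, Finset.sum_range_succ _ (m + 1)]
    push_cast
    ring

end WeightedSum

section LocalRing

variable {A : Type u} [CommRing A] [IsLocalRing A]

theorem maximalIdeal_pow_add_eq {x : A} {r : ℕ}
    (hr : maximalIdeal A ^ (r + 1) = Ideal.span {x} * maximalIdeal A ^ r) (k : ℕ) :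
    maximalIdeal A ^ (r + k) = Ideal.span {x ^ k} * maximalIdeal A ^ r := by
  induction k with
  | zero => simp
  | succ k ih =>
    rw [← add_assoc, pow_succ, ih, mul_assoc, ← pow_succ, hr, ← mul_assoc,
      Ideal.span_singleton_mul_span_singleton, pow_succ]

theorem maximalIdeal_pow_succ_eq {x : A} {r : ℕ}
    (hr : maximalIdeal A ^ (r + 1) = Ideal.span {x} * maximalIdeal A ^ r) {n : ℕ} (hn : r ≤ n) :
    maximalIdeal A ^ (n + 1) = Ideal.span {x} * maximalIdeal A ^ n := by
  obtain ⟨k, rfl⟩ := Nat.exists_eq_add_of_le hn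
  rw [add_assoc, maximalIdeal_pow_add_eq hr, maximalIdeal_pow_add_eq hr, ← mul_assoc,
    Ideal.span_singleton_mul_span_singleton, pow_succ']

variable [IsNoetherianRing A]

/-- The maximal ideal of `A ⧸ N` is nilpotent, so this Noetherian ring is Artinian, and `P / N`
embeds in it. -/
theorem eRelLength_ne_top {n : ℕ} {P N : Ideal A} (h : maximalIdeal A ^ n ≤ N) :
    eRelLength P N ≠ ⊤ := by
  have h1 : Module.length A (A ⧸ N) ≠ ⊤ := by
    have hsurj : Function.Surjective (algebraMap A (A ⧸ N)) := Ideal.Quotient.mk_surjective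
    rw [Module.length_eq_of_surjective (S := A) (R := A ⧸ N) hsurj]
    have : IsArtinianRing (A ⧸ N) := by
      by_cases hN : N = ⊤
      · have : Subsingleton (A ⧸ N) := Ideal.Quotient.subsingleton_iff.mpr hN
        infer_instance
      have : Nontrivial (A ⧸ N) := Ideal.Quotient.nontrivial_iff.mpr hN
      have : IsLocalRing (A ⧸ N) := .of_surjective' (Ideal.Quotient.mk N) hsurj
      rw [isArtinianRing_iff_isNilpotent_maximalIdeal]
      refine ⟨n, ?_⟩
      have hle : maximalIdeal (A ⧸ N) ≤ (maximalIdeal A).map (Ideal.Quotient.mk N) := by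
        intro y hy
        obtain ⟨a, rfl⟩ := hsurj y
        exact Ideal.mem_map_of_mem _ fun ha => hy (ha.map _)
      rw [Ideal.zero_eq_bot, eq_bot_iff]
      refine (Ideal.pow_right_mono hle n).trans ?_
      rw [← Ideal.map_pow, Ideal.map_le_iff_le_comap, ← RingHom.ker_eq_comap_bot, Ideal.mk_ker]
      exact h
    exact Module.length_ne_top
  have h2 : eRelLength P N ≤ Module.length A (A ⧸ N) := by
    refine Module.length_le_of_injective
      (Submodule.mapQ (N.submoduleOf P) N P.subtype fun _ h => h) ?_
    rw [← LinearMap.ker_eq_bot, LinearMap.ker_eq_bot']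
    intro y hy
    obtain ⟨y, rfl⟩ := Submodule.Quotient.mk_surjective _ y
    exact (Submodule.Quotient.mk_eq_zero _).mpr ((Submodule.Quotient.mk_eq_zero N).mp hy)
  exact ne_top_of_le_ne_top h1 h2

end LocalRing

end TangentCone

end

/-! ### Apery invariants and the reference length. -/

noncomputable section

namespace TangentCone

universe u

section Apery

theorem relLength_span_mul {A : Type u} [CommRing A] {x : A} (hx : x ∈ A⁰) (P N : Ideal A) :
    relLength (Ideal.span {x} * P) (Ideal.span {x} * N) = relLength P N := by
  have hinj : Function.Injective (LinearMap.mulLeft A x) := fun a b h =>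
    (mul_cancel_left_mem_nonZeroDivisors hx).mp h
  have hmap : ∀ I : Ideal A, Ideal.span {x} * I = Submodule.map (LinearMap.mulLeft A x) I := by
    intro I
    ext y
    rw [Ideal.mem_span_singleton_mul]
    rfl
  rw [hmap, hmap, relLength_map hinj]

variable {A : Type u} [CommRing A] [IsLocalRing A] {x : A} {r : ℕ}

theorem maximalIdeal_pow_le_span_pow
    (hr : maximalIdeal A ^ (r + 1) = Ideal.span {x} * maximalIdeal A ^ r) (k : ℕ) :
    maximalIdeal A ^ (r + k) ≤ Ideal.span {x ^ k} :=
  (maximalIdeal_pow_add_eq hr k).trans_le Ideal.mul_le_left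

theorem maximalIdeal_pow_le_span
    (hr : maximalIdeal A ^ (r + 1) = Ideal.span {x} * maximalIdeal A ^ r) :
    maximalIdeal A ^ (r + 1) ≤ Ideal.span {x} :=
  hr.trans_le Ideal.mul_le_left

theorem span_mul_le_inf (hxm : x ∈ maximalIdeal A) (i : ℕ) :
    Ideal.span {x} * maximalIdeal A ^ i ≤ maximalIdeal A ^ (i + 1) ⊓ Ideal.span {x} := by
  refine le_inf ?_ Ideal.mul_le_left
  rw [pow_succ']
  exact Ideal.mul_mono_left ((Ideal.span_singleton_le_iff_mem _).mpr hxm)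

variable [IsNoetherianRing A]

/-- Each `γ i` is a difference of consecutive values of `λ((𝔪 ^ i + xA) / xA)`, which vanishes for
`i = r + 1`; summation by parts and the second isomorphism theorem finish. -/
theorem weightedSum_aperyInvariant
    (hr : maximalIdeal A ^ (r + 1) = Ideal.span {x} * maximalIdeal A ^ r) :
    weightedSum r (fun i => (aperyInvariant x i : ℤ)) =
      ((∑ i ∈ Finset.range r, relLength (maximalIdeal A ^ (i + 1))
        (maximalIdeal A ^ (i + 1) ⊓ Ideal.span {x}) : ℕ) : ℤ) := by
  set X := Ideal.span {x} with hX
  have hXr := maximalIdeal_pow_le_span hr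
  have hδ : ∀ i, relLength (maximalIdeal A ^ i ⊔ X) X =
      aperyInvariant x i + relLength (maximalIdeal A ^ (i + 1) ⊔ X) X := fun i => by
    rw [relLength_add (P := maximalIdeal A ^ (i + 1) ⊔ X) le_sup_right
      (sup_le_sup_right (Ideal.pow_le_pow_right i.le_succ) _) (eRelLength_ne_top hXr), add_comm]
    rfl
  have h0 : relLength (maximalIdeal A ^ (r + 1) ⊔ X) X = 0 :=
    (relLength_eq_zero_iff (eRelLength_ne_top hXr)).mpr (sup_le hXr le_rfl)
  rw [weightedSum_eq_sum_sub (L := fun j => (relLength (maximalIdeal A ^ (j + 1) ⊔ X) X : ℤ))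
    fun i => by rw [hδ (i + 1)]; push_cast; ring]
  simp only [h0, Nat.cast_zero, mul_zero, sub_zero, Nat.cast_sum]
  exact Finset.sum_congr rfl fun i _ => by rw [relLength_sup]

/-- Insert `x 𝔪 ^ m` between `x ^ (m+1) A` and `𝔪 ^ (m+1)`. As `x` is regular, the lower factor is
isomorphic to `𝔪 ^ m / x ^ m A`, and induction applies. -/
theorem relLength_pow_span_pow (hx : x ∈ A⁰) (hxm : x ∈ maximalIdeal A)
    (hr : maximalIdeal A ^ (r + 1) = Ideal.span {x} * maximalIdeal A ^ r) (m : ℕ) :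
    relLength (maximalIdeal A ^ m) (Ideal.span {x ^ m}) =
      ∑ i ∈ Finset.range m,
        relLength (maximalIdeal A ^ (i + 1)) (Ideal.span {x} * maximalIdeal A ^ i) := by
  have hle : ∀ i, Ideal.span {x ^ i} ≤ maximalIdeal A ^ i := fun i => by
    rw [Ideal.span_singleton_le_iff_mem]
    exact Ideal.pow_mem_pow hxm i
  induction m with
  | zero =>
    rw [Finset.sum_range_zero, relLength_eq_zero_iff
      (eRelLength_ne_top (maximalIdeal_pow_le_span_pow hr 0))]
    simp
  | succ m ih =>
    have hspan : Ideal.span {x ^ (m + 1)} = Ideal.span {x} * Ideal.span {x ^ m} := by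
      rw [Ideal.span_singleton_mul_span_singleton, pow_succ']
    rw [Finset.sum_range_succ, ← ih, ← relLength_span_mul hx (maximalIdeal A ^ m), ← hspan]
    refine relLength_add ?_ ?_ (eRelLength_ne_top (maximalIdeal_pow_le_span_pow hr (m + 1)))
    · rw [hspan]
      exact Ideal.mul_mono_right (hle m)
    · rw [pow_succ']
      exact Ideal.mul_mono_left ((Ideal.span_singleton_le_iff_mem _).mpr hxm)

/-- The quotient `𝔪 ^ k / x 𝔪 ^ (k+1)` is filtered through `𝔪 ^ (k+1)` and through `x 𝔪 ^ k`. The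
factors `𝔪 ^ k / 𝔪 ^ (k+1)` and `x 𝔪 ^ k / x 𝔪 ^ (k+1)` have equal length, so the other two do as
well. The induction descends from `r`, where `x 𝔪 ^ r = 𝔪 ^ (r+1)`. -/
theorem relLength_pow_span_mul (hx : x ∈ A⁰) (hxm : x ∈ maximalIdeal A)
    (hr : maximalIdeal A ^ (r + 1) = Ideal.span {x} * maximalIdeal A ^ r) {i : ℕ} (hi : i ≤ r) :
    relLength (maximalIdeal A ^ i) (Ideal.span {x} * maximalIdeal A ^ i) =
      relLength (maximalIdeal A ^ r) (maximalIdeal A ^ (r + 1)) := by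
  have hsub : ∀ n, Ideal.span {x} * maximalIdeal A ^ n ≤ maximalIdeal A ^ (n + 1) := fun n => by
    rw [pow_succ']
    exact Ideal.mul_mono_left ((Ideal.span_singleton_le_iff_mem _).mpr hxm)
  have hfin : ∀ P n, eRelLength P (Ideal.span {x} * maximalIdeal A ^ n) ≠ ⊤ := fun P n => by
    refine eRelLength_ne_top (n := r + 1 + n) ?_
    rw [pow_add]
    exact Ideal.mul_mono_left (maximalIdeal_pow_le_span hr)
  refine Nat.decreasingInduction' (P := fun i => relLength (maximalIdeal A ^ i)
    (Ideal.span {x} * maximalIdeal A ^ i) = _) (fun k _ _ ih => ?_) hi (by rw [hr])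
  have h1 := relLength_add (N := Ideal.span {x} * maximalIdeal A ^ (k + 1))
    (P := maximalIdeal A ^ (k + 1)) (Q := maximalIdeal A ^ k) Ideal.mul_le_right
    (Ideal.pow_le_pow_right k.le_succ) (hfin _ _)
  have h2 := relLength_add (N := Ideal.span {x} * maximalIdeal A ^ (k + 1))
    (P := Ideal.span {x} * maximalIdeal A ^ k) (Q := maximalIdeal A ^ k)
    (Ideal.mul_mono_right (Ideal.pow_le_pow_right k.le_succ)) Ideal.mul_le_right (hfin _ _)
  rw [relLength_span_mul hx] at h2
  omega

theorem relLength_pow_add_hilbert (hx : x ∈ A⁰) (hxm : x ∈ maximalIdeal A)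
    (hr : maximalIdeal A ^ (r + 1) = Ideal.span {x} * maximalIdeal A ^ r) {i : ℕ} (hi : i ≤ r) :
    relLength (maximalIdeal A ^ (i + 1)) (Ideal.span {x} * maximalIdeal A ^ i) +
        relLength (maximalIdeal A ^ i) (maximalIdeal A ^ (i + 1)) =
      relLength (maximalIdeal A ^ r) (maximalIdeal A ^ (r + 1)) := by
  rw [← relLength_pow_span_mul hx hxm hr hi]
  refine (relLength_add ?_ (Ideal.pow_le_pow_right i.le_succ)
    (eRelLength_ne_top (n := r + 1 + i) ?_)).symm
  · rw [pow_succ']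
    exact Ideal.mul_mono_left ((Ideal.span_singleton_le_iff_mem _).mpr hxm)
  · rw [pow_add]
    exact Ideal.mul_mono_left (maximalIdeal_pow_le_span hr)

/-- This expresses the reference length through the Hilbert function alone, ready for comparison
with a decomposition of the cone. -/
theorem relLength_pow_span_pow_add_sum (hx : x ∈ A⁰) (hxm : x ∈ maximalIdeal A)
    (hr : maximalIdeal A ^ (r + 1) = Ideal.span {x} * maximalIdeal A ^ r) :
    relLength (maximalIdeal A ^ r) (Ideal.span {x ^ r}) +
        ∑ i ∈ Finset.range r, relLength (maximalIdeal A ^ i) (maximalIdeal A ^ (i + 1)) =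
      r * relLength (maximalIdeal A ^ r) (maximalIdeal A ^ (r + 1)) := by
  rw [relLength_pow_span_pow hx hxm hr, ← Finset.sum_add_distrib, Finset.sum_congr rfl fun i hi =>
    relLength_pow_add_hilbert hx hxm hr (Finset.mem_range.mp hi).le]
  simp

theorem relLength_eq_relLength_inf_add (hxm : x ∈ maximalIdeal A)
    (hr : maximalIdeal A ^ (r + 1) = Ideal.span {x} * maximalIdeal A ^ r) (i : ℕ) :
    relLength (maximalIdeal A ^ (i + 1)) (Ideal.span {x} * maximalIdeal A ^ i) =
      relLength (maximalIdeal A ^ (i + 1) ⊓ Ideal.span {x})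
        (Ideal.span {x} * maximalIdeal A ^ i) +
      relLength (maximalIdeal A ^ (i + 1)) (maximalIdeal A ^ (i + 1) ⊓ Ideal.span {x}) := by
  refine relLength_add (span_mul_le_inf hxm i) inf_le_left
    (eRelLength_ne_top (n := r + 1 + i) ?_)
  rw [pow_add]
  exact Ideal.mul_mono_left (maximalIdeal_pow_le_span hr)

theorem weightedSum_aperyInvariant_le (hx : x ∈ A⁰) (hxm : x ∈ maximalIdeal A)
    (hr : maximalIdeal A ^ (r + 1) = Ideal.span {x} * maximalIdeal A ^ r) :
    weightedSum r (fun i => (aperyInvariant x i : ℤ)) ≤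
      relLength (maximalIdeal A ^ r) (Ideal.span {x ^ r}) := by
  rw [weightedSum_aperyInvariant hr, relLength_pow_span_pow hx hxm hr, Nat.cast_le]
  refine Finset.sum_le_sum fun i _ => ?_
  rw [relLength_eq_relLength_inf_add hxm hr]
  exact Nat.le_add_left _ _

/-- The termwise gap is `λ((𝔪 ^ (i+1) ∩ xA) / x 𝔪 ^ i)`. Equality of the sums forces it to vanish
for `i < r`; for `i ≥ r` it vanishes anyway, since `𝔪 ^ (i+1) = x 𝔪 ^ i`. -/
theorem weightedSum_aperyInvariant_eq_iff (hx : x ∈ A⁰) (hxm : x ∈ maximalIdeal A)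
    (hr : maximalIdeal A ^ (r + 1) = Ideal.span {x} * maximalIdeal A ^ r) :
    weightedSum r (fun i => (aperyInvariant x i : ℤ)) =
        relLength (maximalIdeal A ^ r) (Ideal.span {x ^ r}) ↔
      ∀ i, maximalIdeal A ^ (i + 1) ⊓ Ideal.span {x} ≤ Ideal.span {x} * maximalIdeal A ^ i := by
  have hfin : ∀ P n, eRelLength P (Ideal.span {x} * maximalIdeal A ^ n) ≠ ⊤ := fun P n => by
    refine eRelLength_ne_top (n := r + 1 + n) ?_
    rw [pow_add]
    exact Ideal.mul_mono_left (maximalIdeal_pow_le_span hr)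
  rw [weightedSum_aperyInvariant hr, relLength_pow_span_pow hx hxm hr, Nat.cast_inj,
    Finset.sum_eq_sum_iff_of_le fun i _ => by
      rw [relLength_eq_relLength_inf_add hxm hr i]; exact Nat.le_add_left _ _]
  constructor
  · intro h i
    by_cases hi : i < r
    · have := h i (Finset.mem_range.mpr hi)
      rw [relLength_eq_relLength_inf_add hxm hr i, right_eq_add] at this
      exact (relLength_eq_zero_iff (hfin _ _)).mp this
    · exact inf_le_left.trans (maximalIdeal_pow_succ_eq hr (not_lt.mp hi)).le
  · intro h i _
    rw [relLength_eq_relLength_inf_add hxm hr i, right_eq_add]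
    exact (relLength_eq_zero_iff (hfin _ _)).mpr (h i)

end Apery

/-! ### Regularity of the initial form of `x`. -/

section Regular

variable {A : Type u} [CommRing A] [IsLocalRing A] {x : A}

theorem FiberCone.map_xStar (hxm : Ideal.span {x} ≤ maximalIdeal A) :
    FiberCone.map hxm (xStar x) = FiberCone.of (maximalIdeal A) 1
      ⟨x, by rw [pow_one]; exact hxm (Ideal.mem_span_singleton_self x)⟩ := rfl

theorem FiberCone.map_xStar_mul_of (hxm : Ideal.span {x} ≤ maximalIdeal A) (n : ℕ)
    (c : ↥(maximalIdeal A ^ n)) :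
    FiberCone.map hxm (xStar x) * FiberCone.of (maximalIdeal A) n c = 0 ↔
      x * (c : A) ∈ maximalIdeal A ^ (n + 2) := by
  rw [FiberCone.map_xStar, FiberCone.of_mul_of, FiberCone.of_eq_zero_iff, ← pow_succ',
    show 1 + n + 1 = n + 2 by omega]

/-- The initial form of `x` is regular on the tangent cone if and only if
`𝔪 ^ (i + 1) ∩ xA = x 𝔪 ^ i` for all `i`. -/
theorem isRegular_xStar_iff (hx : x ∈ A⁰) (hxm : Ideal.span {x} ≤ maximalIdeal A) :
    (∀ g : Cone A, FiberCone.map hxm (xStar x) * g = 0 → g = 0) ↔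
      ∀ i, maximalIdeal A ^ (i + 1) ⊓ Ideal.span {x} ≤ Ideal.span {x} * maximalIdeal A ^ i := by
  constructor
  · rintro h i y ⟨hy, hyx⟩
    obtain ⟨c, rfl⟩ := Ideal.mem_span_singleton'.mp hyx
    rw [mul_comm c x]
    refine Ideal.mul_mem_mul (Ideal.mem_span_singleton_self x) ?_
    -- The order of `c` is raised one step at a time: if `c ∈ 𝔪 ^ k` with `k < i`, then `x c ∈ 𝔪 ^
    -- (k+2)`, so the initial form of `x` kills the class of `c` in degree `k`, and that class is
    -- zero.
    suffices ∀ k ≤ i, c ∈ maximalIdeal A ^ k from this i le_rfl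
    intro k
    induction k with
    | zero => simp
    | succ k ih =>
      intro hk
      have hck := ih (by omega)
      have h0 := h (FiberCone.of (maximalIdeal A) k ⟨c, hck⟩)
        ((FiberCone.map_xStar_mul_of hxm k _).mpr
          (Ideal.pow_le_pow_right (by omega) (mul_comm c x ▸ hy)))
      rw [FiberCone.of_eq_zero_iff, ← pow_succ'] at h0
      exact h0
  · intro h g hg
    refine FiberCone.eq_zero_of_proj fun n => ?_
    have hT : FiberCone.map hxm (xStar x) ∈ FiberCone.piece (maximalIdeal A) 1 :=
      FiberCone.map_mem_piece hxm (FiberCone.of_mem_piece _ _)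
    have h1 : FiberCone.map hxm (xStar x) * FiberCone.proj (maximalIdeal A) n g = 0 := by
      have := FiberCone.proj_mul_of_mem hT g (n + 1)
      rw [mul_comm g, hg, map_zero, if_pos (by omega), Nat.add_sub_cancel] at this
      rw [mul_comm, ← this]
    obtain ⟨c, hc⟩ := FiberCone.proj_mem n g
    rw [← hc] at h1 ⊢
    rw [FiberCone.map_xStar_mul_of] at h1
    have h2 := h (n + 1) ⟨h1, Ideal.mem_span_singleton'.mpr ⟨c, mul_comm _ _⟩⟩
    obtain ⟨d, hd, hdc⟩ := Ideal.mem_span_singleton_mul.mp h2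
    rw [FiberCone.of_eq_zero_iff, ← pow_succ',
      ← (mul_cancel_left_mem_nonZeroDivisors hx).mp hdc]
    exact hd

end Regular

/-! ### The first neighborhood ring and the micro-invariants. -/

section Neighborhood

variable {A : Type u} [CommRing A] [IsLocalRing A] {x : A} {r : ℕ}

/-- The single denominator `x ^ r` suffices. For `b / a` with `a` superficial of degree `s`, and `N`
large, `x ^ (r+N) b` lies in `𝔪 ^ (r+N+s) = a 𝔪 ^ (r+N) = a x ^ N 𝔪 ^ r`; cancel the regular element
`x ^ N a`. Conversely `x ^ r` is itself superficial of degree `r`. -/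
theorem mem_firstNeighborhoodRing_iff (hx : x ∈ A⁰) (hxm : x ∈ maximalIdeal A)
    (hr : maximalIdeal A ^ (r + 1) = Ideal.span {x} * maximalIdeal A ^ r) (q : FractionRing A) :
    q ∈ firstNeighborhoodRing A ↔
      ∃ c ∈ maximalIdeal A ^ r, algebraMap A (FractionRing A) (x ^ r) * q =
        algebraMap A (FractionRing A) c := by
  constructor
  · rintro ⟨s, a, b, ⟨ha, N, hN⟩, hb, rfl⟩
    have h1 : x ^ (r + N) * b ∈ Ideal.span {(a : A)} * maximalIdeal A ^ (r + N) := by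
      rw [← hN _ (Nat.le_add_left _ _), pow_add _ (r + N)]
      exact Ideal.mul_mem_mul (Ideal.pow_mem_pow hxm _) hb
    obtain ⟨c, hc, hcb⟩ := Ideal.mem_span_singleton_mul.mp h1
    rw [maximalIdeal_pow_add_eq hr] at hc
    obtain ⟨d, hd, rfl⟩ := Ideal.mem_span_singleton_mul.mp hc
    refine ⟨d, hd, ?_⟩
    have hu : IsUnit (algebraMap A (FractionRing A) (x ^ N * a)) :=
      IsLocalization.map_units _ (⟨x ^ N, pow_mem hx N⟩ * a : A⁰)
    apply hu.mul_left_cancel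
    have hspec := IsLocalization.mk'_spec' (FractionRing A) b a
    calc _ = algebraMap A (FractionRing A) (x ^ (r + N)) *
          (algebraMap A (FractionRing A) a * IsLocalization.mk' (FractionRing A) b a) := by
          simp only [map_mul, map_pow, pow_add]
          ring
      _ = _ := by
          rw [hspec, ← map_mul, ← map_mul, ← hcb]
          congr 1
          ring
  · rintro ⟨c, hc, h⟩
    refine ⟨r, ⟨x ^ r, pow_mem hx r⟩, c, ⟨Ideal.pow_mem_pow hxm r, r, fun n hn => ?_⟩, hc, ?_⟩
    · obtain ⟨k, rfl⟩ := Nat.exists_eq_add_of_le hn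
      rw [add_assoc, maximalIdeal_pow_add_eq hr, maximalIdeal_pow_add_eq hr k, ← mul_assoc,
        Ideal.span_singleton_mul_span_singleton, ← pow_add, add_comm k]
    · rw [IsLocalization.eq_mk'_iff_mul_eq, mul_comm]
      exact h

/-- Multiplication by `x ^ r` identifies the first neighborhood ring with `𝔪 ^ r`. -/
theorem map_mulLeft_firstNeighborhoodRing (hx : x ∈ A⁰) (hxm : x ∈ maximalIdeal A)
    (hr : maximalIdeal A ^ (r + 1) = Ideal.span {x} * maximalIdeal A ^ r) :
    (Subalgebra.toSubmodule (firstNeighborhoodRing A)).map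
        (LinearMap.mulLeft A (algebraMap A (FractionRing A) (x ^ r))) =
      Submodule.map (Algebra.linearMap A (FractionRing A)) (maximalIdeal A ^ r) := by
  ext y
  constructor
  · rintro ⟨q, hq, rfl⟩
    obtain ⟨c, hc, h⟩ := (mem_firstNeighborhoodRing_iff hx hxm hr q).mp hq
    exact ⟨c, hc, h.symm⟩
  · rintro ⟨c, hc, rfl⟩
    refine ⟨IsLocalization.mk' (FractionRing A) c (⟨x ^ r, pow_mem hx r⟩ : A⁰),
      (mem_firstNeighborhoodRing_iff hx hxm hr _).mpr ⟨c, hc, ?_⟩, ?_⟩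
    · exact IsLocalization.mk'_spec' _ c (⟨x ^ r, pow_mem hx r⟩ : A⁰)
    · exact IsLocalization.mk'_spec' _ c (⟨x ^ r, pow_mem hx r⟩ : A⁰)

variable (A) in
theorem antitone_neighborhoodFiltration : Antitone (neighborhoodFiltration A) := fun _ _ h =>
  sup_le_sup_left (Submodule.smul_mono_left (Ideal.pow_le_pow_right h)) _

variable (A) in
theorem neighborhoodFiltration_zero :
    neighborhoodFiltration A 0 = Subalgebra.toSubmodule (firstNeighborhoodRing A) := by
  rw [neighborhoodFiltration, pow_zero, Ideal.one_eq_top, Submodule.top_smul, sup_eq_right]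
  intro y hy
  obtain ⟨a, rfl⟩ := Submodule.mem_one.mp hy
  exact (firstNeighborhoodRing A).algebraMap_mem a

/-- Multiplying by `x ^ r` moves `𝔪 ^ i A'` into `𝔪 ^ (2r)`, which is contained in `x ^ r A`; hence
`𝔪 ^ i A' ⊆ A`. -/
theorem neighborhoodFiltration_eq_one (hx : x ∈ A⁰) (hxm : x ∈ maximalIdeal A)
    (hr : maximalIdeal A ^ (r + 1) = Ideal.span {x} * maximalIdeal A ^ r) {i : ℕ} (hi : r ≤ i) :
    neighborhoodFiltration A i = 1 := by
  rw [neighborhoodFiltration, sup_eq_left, Submodule.smul_le]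
  intro a ha q hq
  obtain ⟨c, hc, h⟩ := (mem_firstNeighborhoodRing_iff hx hxm hr q).mp hq
  have h1 : a * c ∈ maximalIdeal A ^ (r + r) :=
    pow_add (maximalIdeal A) r r ▸ Ideal.mul_mem_mul (Ideal.pow_le_pow_right hi ha) hc
  obtain ⟨d, hd⟩ := Ideal.mem_span_singleton'.mp (maximalIdeal_pow_le_span_pow hr r h1)
  refine Submodule.mem_one.mpr ⟨d, ?_⟩
  have hu : IsUnit (algebraMap A (FractionRing A) (x ^ r)) :=
    IsLocalization.map_units _ (⟨x ^ r, pow_mem hx r⟩ : A⁰)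
  apply hu.mul_left_cancel
  rw [Algebra.smul_def, mul_left_comm, h, ← map_mul, ← map_mul, ← hd, mul_comm]

/-- The weighted sum of the micro-invariants is the length of `A' / A`, that is of
`𝔪 ^ r / x ^ r A`. -/
theorem weightedSum_microInvariant [IsNoetherianRing A] (hx : x ∈ A⁰) (hxm : x ∈ maximalIdeal A)
    (hr : maximalIdeal A ^ (r + 1) = Ideal.span {x} * maximalIdeal A ^ r) :
    weightedSum r (fun i => microInvariant A i) =
      relLength (maximalIdeal A ^ r) (Ideal.span {x ^ r}) := by
  have hu : IsUnit (algebraMap A (FractionRing A) (x ^ r)) :=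
    IsLocalization.map_units _ (⟨x ^ r, pow_mem hx r⟩ : A⁰)
  have hinj : Function.Injective
      (LinearMap.mulLeft A (algebraMap A (FractionRing A) (x ^ r))) := fun _ _ h =>
    hu.mul_left_cancel h
  have hmap : (1 : Submodule A (FractionRing A)).map
        (LinearMap.mulLeft A (algebraMap A (FractionRing A) (x ^ r))) =
      Submodule.map (Algebra.linearMap A (FractionRing A)) (Ideal.span {x ^ r}) := by
    ext y
    constructor
    · rintro ⟨q, hq, rfl⟩
      obtain ⟨a, rfl⟩ := Submodule.mem_one.mp hq
      exact ⟨a * x ^ r, Ideal.mem_span_singleton'.mpr ⟨a, rfl⟩, by simp [mul_comm]⟩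
    · rintro ⟨c, hc, rfl⟩
      obtain ⟨a, rfl⟩ := Ideal.mem_span_singleton'.mp hc
      exact ⟨_, Submodule.mem_one.mpr ⟨a, rfl⟩, by simp [mul_comm]⟩
  have hAinj : Function.Injective (Algebra.linearMap A (FractionRing A)) :=
    IsFractionRing.injective A (FractionRing A)
  have hlen : eRelLength (neighborhoodFiltration A 0) (neighborhoodFiltration A r) =
      eRelLength (maximalIdeal A ^ r) (Ideal.span {x ^ r}) := by
    rw [neighborhoodFiltration_zero, neighborhoodFiltration_eq_one hx hxm hr le_rfl,
      ← eRelLength_map hinj, hmap, map_mulLeft_firstNeighborhoodRing hx hxm hr,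
      eRelLength_map hAinj]
  have hfin : eRelLength (maximalIdeal A ^ r) (Ideal.span {x ^ r}) ≠ ⊤ :=
    eRelLength_ne_top (maximalIdeal_pow_le_span_pow hr r)
  have h0 : relLength (neighborhoodFiltration A r) (neighborhoodFiltration A (r + 1)) = 0 := by
    rw [neighborhoodFiltration_eq_one hx hxm hr le_rfl,
      neighborhoodFiltration_eq_one hx hxm hr r.le_succ, relLength_eq_toNat,
      eRelLength_eq_zero_iff.mpr le_rfl, ENat.toNat_zero]
  rw [weightedSum_eq_sum_sub (L := fun j => (relLength (neighborhoodFiltration A j)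
    (neighborhoodFiltration A (j + 1)) : ℤ)) fun i => rfl]
  simp only [h0, Nat.cast_zero, mul_zero, sub_zero]
  rw [← Nat.cast_sum, sum_relLength_of_antitone (antitone_neighborhoodFiltration A) r
    (hlen ▸ hfin), relLength_eq_toNat, hlen, relLength_eq_toNat]

end Neighborhood

end TangentCone

end

/-! ### Commutative algebra of one-dimensional Cohen–Macaulay rings. -/

noncomputable section

namespace TangentCone

universe u

section Algebra

/-- Localizing a ring at a maximal ideal gives a Cohen–Macaulay ring of dimension one as soon as
some regular element of the ideal lies in no other prime contained in it. -/
theorem isCohenMacaulayLocalRing_localization_of_regular {G : Type u} [CommRing G]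
    [IsNoetherianRing G] (p : Ideal G) [p.IsMaximal] {y : G} (hy : y ∈ G⁰) (hyp : y ∈ p)
    (hmax : ∀ q : Ideal G, q.IsPrime → y ∈ q → q.IsMaximal) :
    IsCohenMacaulayLocalRing (Localization.AtPrime p) := by
  set R := Localization.AtPrime p
  have : IsNoetherianRing R := IsLocalization.isNoetherianRing p.primeCompl R inferInstance
  have hyR : algebraMap G R y ∈ R⁰ :=
    IsLocalization.map_nonZeroDivisors_le p.primeCompl R (Submonoid.mem_map_of_mem _ hy)
  have hym : algebraMap G R y ∈ maximalIdeal R :=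
    (IsLocalization.AtPrime.to_map_mem_maximal_iff R p y).mpr hyp
  -- The contraction of `q` contains `y`, so it is maximal; being contained in `p`, it equals `p`.
  have hprime : ∀ q : Ideal R, q.IsPrime → algebraMap G R y ∈ q → q = maximalIdeal R := by
    intro q hq hyq
    refine le_antisymm (IsLocalRing.le_maximalIdeal hq.ne_top) fun z hz => ?_
    have hqp : q.comap (algebraMap G R) ≤ p := fun a ha =>
      (IsLocalization.AtPrime.to_map_mem_maximal_iff R p a).mp
        (IsLocalRing.le_maximalIdeal hq.ne_top ha)
    have hqm : (q.comap (algebraMap G R)).IsMaximal :=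
      hmax _ (Ideal.IsPrime.comap (algebraMap G R)) hyq
    have heq := hqm.eq_of_le (Ideal.IsPrime.ne_top inferInstance) hqp
    obtain ⟨a, s, rfl⟩ := IsLocalization.exists_mk'_eq p.primeCompl z
    rw [IsLocalization.AtPrime.mk'_mem_maximal_iff R p] at hz
    rw [IsLocalization.mk'_mem_iff]
    rw [← heq] at hz
    exact hz
  have hne : Ideal.span {algebraMap G R y} ≠ ⊤ := fun h =>
    (Ideal.ne_top_iff_one _).mp (Ideal.IsPrime.ne_top (maximalIdeal.isMaximal R).isPrime)
      ((Ideal.span_singleton_le_iff_mem _).mpr hym (h ▸ Submodule.mem_top))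
  have : Nontrivial (R ⧸ Ideal.span {algebraMap G R y}) := Ideal.Quotient.nontrivial_iff.mpr hne
  have hsurj := Ideal.Quotient.mk_surjective (I := Ideal.span {algebraMap G R y})
  have h0 : ringKrullDim (R ⧸ Ideal.span {algebraMap G R y}) = 0 := by
    have : Ring.KrullDimLE 0 (R ⧸ Ideal.span {algebraMap G R y}) := .mk₀ fun J hJ => by
      have hJm := hprime (J.comap (Ideal.Quotient.mk _)) (Ideal.IsPrime.comap _) (by
        rw [Ideal.mem_comap, Ideal.Quotient.eq_zero_iff_mem.mpr (Ideal.mem_span_singleton_self _)]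
        exact J.zero_mem)
      have h := Ideal.map_eq_top_or_isMaximal_of_surjective (Ideal.Quotient.mk _) hsurj
        (maximalIdeal.isMaximal R)
      rw [← hJm, Ideal.map_comap_of_surjective _ hsurj] at h
      exact h.resolve_left hJ.ne_top
    exact le_antisymm (by simpa using Ring.krullDimLE_iff.mp this) ringKrullDim_nonneg_of_nontrivial
  refine ⟨inferInstance, [algebraMap G R y], by simpa using hym, ?_, ?_⟩
  · rw [IsLocalRing.isRegular_iff_isWeaklyRegular_of_subset_maximalIdeal (by simpa using hym),
      RingTheory.Sequence.isWeaklyRegular_singleton_iff]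
    exact Module.Flat.isSMulRegular_of_nonZeroDivisors hyR
  · rw [← ringKrullDim_quotient_span_singleton_succ_eq_ringKrullDim_of_mem_nonZeroDivisors hyR hym,
      h0]
    simp

/-- If `G` is a torsion-free algebra that is integral over a principal ideal domain which is not a
field, then its localizations at maximal ideals are Cohen–Macaulay. -/
theorem isCohenMacaulayRing_of_isIntegral {P G : Type u} [CommRing P] [IsDomain P]
    [IsPrincipalIdealRing P] (hP : ¬ IsField P) [CommRing G] [IsNoetherianRing G] [Algebra P G]
    [Algebra.IsIntegral P G] (h : ∀ f : P, f ≠ 0 → algebraMap P G f ∈ G⁰) :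
    IsCohenMacaulayRing G := by
  refine ⟨inferInstance, fun p hp => ?_⟩
  have hmax := Ideal.isMaximal_comap_of_isIntegral_of_isMaximal (R := P) p
  obtain ⟨f, hf, hf0⟩ :=
    Submodule.exists_mem_ne_zero_of_ne_bot (Ring.ne_bot_of_isMaximal_of_not_isField hmax hP)
  refine isCohenMacaulayLocalRing_localization_of_regular p (h f hf0) hf fun q hq hfq => ?_
  have hc : (q.comap (algebraMap P G)).IsPrime := Ideal.IsPrime.comap _
  exact Ideal.isMaximal_of_isIntegral_of_isMaximal_comap q
    (hc.isMaximal fun hbot => hf0 (by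
      have : f ∈ q.comap (algebraMap P G) := hfq
      rwa [hbot] at this))

/-- If the localization of `G` at `p` is Cohen–Macaulay and `T` is not nilpotent there, then an
element `T ∈ p` dividing all elements of some power of `p` is regular. -/
theorem regular_of_isCohenMacaulayLocalRing {G : Type u} [CommRing G] (p : Ideal G) [p.IsMaximal]
    (h : IsCohenMacaulayLocalRing (Localization.AtPrime p)) {T : G} (hT : T ∈ p)
    (hnil : ∀ s ∉ p, ∀ m : ℕ, s * T ^ m ≠ 0) {N : ℕ} (hN : p ^ N ≤ Ideal.span {T})
    {g : G} (hg : T * g = 0) : g = 0 := by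
  have hpg : ∀ b ∈ p, b ^ N * g = 0 := fun b hb => by
    obtain ⟨c, hc⟩ := Ideal.mem_span_singleton'.mp (hN (Ideal.pow_mem_pow hb N))
    rw [← hc, mul_assoc, hg, mul_zero]
  -- It is enough that `g` vanishes in the localization: if `s ∉ p` kills `g` and `t s + i = 1` with
  -- `i ∈ p`, then `i` fixes `g`, whereas `i ^ N` kills it.
  suffices hs : ∃ s ∉ p, s * g = 0 by
    obtain ⟨s, hs, hsg⟩ := hs
    obtain ⟨t, i, hi, hti⟩ := Ideal.IsMaximal.exists_inv ‹p.IsMaximal› hs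
    have hig : i * g = g := by
      calc i * g = (t * s + i) * g := by rw [add_mul, mul_assoc, hsg, mul_zero, zero_add]
        _ = g := by rw [hti, one_mul]
    have : ∀ n : ℕ, i ^ n * g = g := fun n => by
      induction n with
      | zero => simp
      | succ n ih => rw [pow_succ, mul_assoc, hig, ih]
    rw [← this N, hpg i hi]
  set R := Localization.AtPrime p
  obtain ⟨hnoeth, rs, hrs, hreg, hdim⟩ := h
  cases rs with
  -- An empty regular sequence means dimension zero, where the maximal ideal is the nilradical,
  -- against the non-nilpotence of `T`.
  | nil =>
    exfalso
    have : Ring.KrullDimLE 0 R := Ring.krullDimLE_iff.mpr (by rw [← hdim]; simp)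
    have hTR : algebraMap G R T ∈ maximalIdeal R :=
      (IsLocalization.AtPrime.to_map_mem_maximal_iff R p T).mpr hT
    have hTn : IsNilpotent (algebraMap G R T) := by
      rw [← mem_nilradical, ← Ring.jacobson_eq_nilradical_of_krullDimLE_zero,
        ← Ideal.jacobson_bot, IsLocalRing.jacobson_eq_maximalIdeal ⊥ bot_ne_top]
      exact hTR
    obtain ⟨m, hm⟩ := hTn
    rw [← map_pow, IsLocalization.map_eq_zero_iff p.primeCompl] at hm
    obtain ⟨s, hs⟩ := hm
    exact hnil s s.2 m hs
  -- The first term of the sequence is a regular element whose numerator lies in `p`; its `N`-th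
  -- power kills `g`, so `g` is zero locally.
  | cons a rs =>
    have ha : IsSMulRegular R a :=
      ((RingTheory.Sequence.isRegular_cons_iff R a rs).mp hreg).1
    have ham : a ∈ maximalIdeal R := hrs a (by simp)
    obtain ⟨b, s, rfl⟩ := IsLocalization.exists_mk'_eq p.primeCompl a
    rw [IsLocalization.AtPrime.mk'_mem_maximal_iff R p] at ham
    have hzero : IsLocalization.mk' R b s ^ N * algebraMap G R g = 0 := by
      refine ((IsLocalization.map_units R s).pow N).mul_left_cancel ?_
      rw [← mul_assoc, ← mul_pow, IsLocalization.mk'_spec', ← map_pow, ← map_mul, hpg b ham,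
        map_zero, mul_zero]
    have hg0 : algebraMap G R g = 0 := (ha.pow N).right_eq_zero_of_smul hzero
    rw [IsLocalization.map_eq_zero_iff p.primeCompl] at hg0
    obtain ⟨s, hs⟩ := hg0
    exact ⟨s, s.2, hs⟩

end Algebra

end TangentCone

end

/-! ### The irrelevant ideal and Cohen–Macaulayness of the tangent cone. -/

noncomputable section

namespace TangentCone

universe u

namespace FiberCone

variable {A : Type u} [CommRing A] [IsLocalRing A]

instance [IsNoetherianRing A] (I : Ideal A) : IsNoetherianRing (FiberCone I) :=
  inferInstanceAs
    (IsNoetherianRing (reesAlgebra I ⧸ (maximalIdeal A).map (algebraMap A (reesAlgebra I))))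

theorem proj_mul_eq_zero {I : Ideal A} {a b : FiberCone I} {n : ℕ}
    (h : ∀ j ≤ n, proj I (n - j) a * proj I j b = 0) : proj I n (a * b) = 0 := by
  obtain ⟨N, hN⟩ := exists_sum_proj b
  rw [hN, Finset.mul_sum, map_sum]
  refine Finset.sum_eq_zero fun j _ => ?_
  rw [proj_mul_of_mem (proj_mem j b)]
  split_ifs with hj
  · exact h j hj
  · rfl

theorem proj_mul_eq {I : Ideal A} {a b : FiberCone I} {m : ℕ} (hb : b ∈ piece I m) :
    proj I m (a * b) = proj I 0 a * b := by
  rw [proj_mul_of_mem hb, if_pos le_rfl, Nat.sub_self]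

/-- The projection of the fiber cone onto its component of degree zero. -/
def augmentation (I : Ideal A) : FiberCone I →+* ResidueField A :=
  Ideal.Quotient.lift _
    ((residue A).comp (constantCoeff.comp (reesAlgebra I).subtype)) fun f hf => by
      have := (mem_map_maximalIdeal_iff I f).mp hf 0
      rw [pow_zero, mul_one] at this
      exact (residue_eq_zero_iff _).mpr this

theorem augmentation_mk (I : Ideal A) (f : reesAlgebra I) :
    augmentation I (mk I f) = residue A ((f : A[X]).coeff 0) := rfl

theorem augmentation_surjective (I : Ideal A) : Function.Surjective (augmentation I) := fun c => by
  obtain ⟨a, rfl⟩ := residue_surjective c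
  refine ⟨mk I (algebraMap A _ a), ?_⟩
  rw [augmentation_mk]
  exact congrArg _ (coeff_C_zero (a := a))

theorem mem_ker_augmentation_iff {I : Ideal A} {g : FiberCone I} :
    g ∈ RingHom.ker (augmentation I) ↔ proj I 0 g = 0 := by
  obtain ⟨f, rfl⟩ := mk_surjective g
  rw [RingHom.mem_ker, augmentation_mk, proj_mk, of_eq_zero_iff, residue_eq_zero_iff]
  simp

/-- The irrelevant ideal lives in positive degrees, so its `m`-th power lives in degrees at least
`m`. -/
theorem proj_eq_zero_of_mem_pow {I : Ideal A} (m : ℕ) : ∀ g ∈ RingHom.ker (augmentation I) ^ m,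
    ∀ n < m, proj I n g = 0 := by
  induction m with
  | zero => intro g _ n hn; omega
  | succ m ih =>
    intro g hg n hn
    rw [pow_succ'] at hg
    induction hg using Submodule.mul_induction_on' with
    | mem_mul_mem a ha b hb =>
      refine proj_mul_eq_zero fun j hj => ?_
      by_cases hjm : j < m
      · rw [ih b hb j hjm, mul_zero]
      · obtain rfl : j = n := by omega
        rw [Nat.sub_self, mem_ker_augmentation_iff.mp ha, zero_mul]
    | add a _ b _ ha hb => rw [map_add, ha, hb, add_zero]

variable {x : A}

theorem xStar_mem_piece : xStar x ∈ piece (Ideal.span {x}) 1 := of_mem_piece _ _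

theorem xStar_pow (m : ℕ) : xStar x ^ m = of (Ideal.span {x}) m
    ⟨x ^ m, Ideal.pow_mem_pow (Ideal.mem_span_singleton_self x) m⟩ := by
  rw [xStar, of_pow]
  exact of_congr (one_mul m) rfl

theorem xStar_pow_mem_piece (m : ℕ) : xStar x ^ m ∈ piece (Ideal.span {x}) m := by
  rw [xStar_pow]
  exact of_mem_piece _ _

theorem mem_piece_span_iff {n : ℕ} {f : NoetherNormalization x} :
    f ∈ piece (Ideal.span {x}) n ↔ ∃ a : A, f = a • xStar x ^ n := by
  constructor
  · rintro ⟨⟨c, hc⟩, rfl⟩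
    have hc' := hc
    rw [Ideal.span_singleton_pow] at hc'
    obtain ⟨a, rfl⟩ := Ideal.mem_span_singleton'.mp hc'
    refine ⟨a, ?_⟩
    rw [xStar_pow, ← map_smul]
    rfl
  · rintro ⟨a, rfl⟩
    exact Submodule.smul_mem _ _ (xStar_pow_mem_piece n)

variable {r : ℕ}

/-- Otherwise `𝔪 ^ (r+n) = x ^ n 𝔪 ^ r ⊆ 𝔪 ^ (r+n+1)`, and Nakayama gives `𝔪 ^ (r+n) = 0`,
contradicting the regularity of `x`. Thus the initial form of `x` is not nilpotent. -/
theorem pow_notMem_maximalIdeal_pow [IsNoetherianRing A] (hx : x ∈ A⁰) (hxm : x ∈ maximalIdeal A)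
    (hr : maximalIdeal A ^ (r + 1) = Ideal.span {x} * maximalIdeal A ^ r) (n : ℕ) :
    x ^ n ∉ maximalIdeal A ^ (n + 1) := by
  intro h
  have h1 : maximalIdeal A ^ (r + n) ≤ maximalIdeal A • maximalIdeal A ^ (r + n) := by
    rw [smul_eq_mul, ← pow_succ']
    conv_lhs => rw [maximalIdeal_pow_add_eq hr n]
    rw [show r + n + 1 = (n + 1) + r by omega, pow_add _ (n + 1)]
    exact Ideal.mul_mono_left ((Ideal.span_singleton_le_iff_mem _).mpr h)
  have h2 := Submodule.eq_bot_of_le_smul_of_le_jacobson_bot _ _ (IsNoetherian.noetherian _) h1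
    (maximalIdeal_le_jacobson _)
  have h3 : x ^ (r + n) ∈ (⊥ : Ideal A) := h2 ▸ Ideal.pow_mem_pow hxm _
  exact nonZeroDivisors.ne_zero (pow_mem hx (r + n)) h3

theorem smul_map_xStar_pow_eq_zero_iff [IsNoetherianRing A] (hx : x ∈ A⁰)
    (hxm : Ideal.span {x} ≤ maximalIdeal A)
    (hr : maximalIdeal A ^ (r + 1) = Ideal.span {x} * maximalIdeal A ^ r) (n : ℕ) (a : A) :
    a • map hxm (xStar x) ^ n = 0 ↔ a ∈ maximalIdeal A := by
  constructor
  · intro h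
    by_contra ha
    rw [mem_maximalIdeal, mem_nonunits_iff, not_not] at ha
    rw [ha.smul_eq_zero, ← map_pow, xStar_pow, map_of, of_eq_zero_iff, ← pow_succ'] at h
    exact pow_notMem_maximalIdeal_pow hx (hxm (Ideal.mem_span_singleton_self x)) hr n h
  · intro h
    exact smul_eq_zero_of_mem h _

theorem exists_eq_map_xStar_mul_of_mem_piece (hxm : Ideal.span {x} ≤ maximalIdeal A)
    (hr : maximalIdeal A ^ (r + 1) = Ideal.span {x} * maximalIdeal A ^ r) {n : ℕ} (hn : r ≤ n)
    {g : Cone A} (hg : g ∈ piece (maximalIdeal A) (n + 1)) :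
    ∃ h ∈ piece (maximalIdeal A) n, g = map hxm (xStar x) * h := by
  obtain ⟨⟨c, hc⟩, rfl⟩ := hg
  have hc' := hc
  rw [maximalIdeal_pow_succ_eq hr hn] at hc'
  obtain ⟨d, hd, rfl⟩ := Ideal.mem_span_singleton_mul.mp hc'
  refine ⟨of _ n ⟨d, hd⟩, of_mem_piece _ _, ?_⟩
  rw [map_xStar, of_mul_of]
  exact of_congr (add_comm n 1) rfl

/-- In degrees above `r` every element of the cone is a multiple of the initial form of `x`. -/
theorem ker_augmentation_pow_le (hxm : Ideal.span {x} ≤ maximalIdeal A)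
    (hr : maximalIdeal A ^ (r + 1) = Ideal.span {x} * maximalIdeal A ^ r) :
    RingHom.ker (augmentation (maximalIdeal A)) ^ (r + 1) ≤
      Ideal.span {map hxm (xStar x)} := by
  intro g hg
  obtain ⟨N, hN⟩ := exists_sum_proj g
  rw [hN]
  refine Ideal.sum_mem _ fun n _ => ?_
  by_cases hn : n < r + 1
  · rw [proj_eq_zero_of_mem_pow _ g hg n hn]
    exact Ideal.zero_mem _
  · obtain ⟨m, rfl⟩ : ∃ m, n = m + 1 := ⟨n - 1, by omega⟩
    obtain ⟨h, -, hh⟩ := exists_eq_map_xStar_mul_of_mem_piece hxm hr (n := m) (by omega)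
      (proj_mem (m + 1) g)
    rw [hh]
    exact Ideal.mul_mem_right _ _ (Ideal.mem_span_singleton_self _)

theorem regular_of_isCohenMacaulayRing [IsNoetherianRing A] (hx : x ∈ A⁰)
    (hxm : Ideal.span {x} ≤ maximalIdeal A)
    (hr : maximalIdeal A ^ (r + 1) = Ideal.span {x} * maximalIdeal A ^ r)
    (h : IsCohenMacaulayRing (Cone A)) (g : Cone A) (hg : map hxm (xStar x) * g = 0) : g = 0 := by
  have hmax : (RingHom.ker (augmentation (maximalIdeal A))).IsMaximal :=
    RingHom.ker_isMaximal_of_surjective _ (augmentation_surjective _)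
  have hT : map hxm (xStar x) ∈ piece (maximalIdeal A) 1 := map_mem_piece hxm xStar_mem_piece
  refine regular_of_isCohenMacaulayLocalRing _ (h.2 _) ?_ ?_ (ker_augmentation_pow_le hxm hr) hg
  · rw [mem_ker_augmentation_iff, proj_of_mem hT, if_neg zero_ne_one]
  -- The degree `m` part of `s T ^ m` is `s₀ T ^ m`, where `s₀` comes from a unit of `A` because `s`
  -- is not in the irrelevant ideal.
  · intro s hs m hsm
    have h1 := proj_mul_eq (a := s) (map_mem_piece hxm (xStar_pow_mem_piece m))
    rw [map_pow, hsm, map_zero] at h1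
    obtain ⟨⟨a, ha⟩, ha'⟩ := proj_mem 0 s
    rw [← ha', ← algebraMap_eq_of (I := maximalIdeal A) a, ← Algebra.smul_def, eq_comm,
      smul_map_xStar_pow_eq_zero_iff hx hxm hr] at h1
    rw [mem_ker_augmentation_iff, ← ha', of_eq_zero_iff] at hs
    exact hs (by simpa using h1)

/-- If the initial form of `x` is regular, so is every nonzero polynomial in it. -/
theorem aeval_mem_nonZeroDivisors (hxm : Ideal.span {x} ≤ maximalIdeal A)
    (h : ∀ g : Cone A, map hxm (xStar x) * g = 0 → g = 0) {f : (ResidueField A)[X]} (hf : f ≠ 0) :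
    aeval (map hxm (xStar x)) f ∈ (Cone A)⁰ := by
  set T := map hxm (xStar x) with hTdef
  have hT : T ∈ piece (maximalIdeal A) 1 := map_mem_piece hxm xStar_mem_piece
  have hpow : ∀ n g, T ^ n * g = 0 → g = 0 := by
    intro n
    induction n with
    | zero => intro g hg; simpa using hg
    | succ n ih =>
      intro g hg
      rw [pow_succ, mul_assoc] at hg
      exact h _ (ih _ hg)
  -- Write `f = X ^ e * q` with `q(0) ≠ 0`; the factor `X ^ e` acts injectively by hypothesis.
  obtain ⟨q, hq, hq0⟩ := f.exists_eq_pow_rootMultiplicity_mul_and_not_dvd hf 0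
  rw [C_0, sub_zero] at hq hq0
  rw [X_dvd_iff] at hq0
  -- If `q(T) g = 0`, inverting the constant coefficient gives `g = T g₁`, and `q(T) g₁ = 0` because
  -- `T` is regular. So `g` is divisible by every power of `T`, which leaves no component in any
  -- degree.
  have hdiv : ∀ m g, aeval T q * g = 0 → ∃ g', g = g' * T ^ m := by
    intro m
    induction m with
    | zero => intro g _; exact ⟨g, by simp⟩
    | succ m ih =>
      intro g hg
      have h1 : algebraMap (ResidueField A) (Cone A) (q.coeff 0)⁻¹ *
          algebraMap (ResidueField A) (Cone A) (q.coeff 0) = 1 := by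
        rw [← map_mul, inv_mul_cancel₀ hq0, map_one]
      have h2 : aeval T q = aeval T q.divX * T +
          algebraMap (ResidueField A) (Cone A) (q.coeff 0) := by
        conv_lhs => rw [← divX_mul_X_add q]
        rw [map_add, map_mul, aeval_X, aeval_C]
      set g1 := -(algebraMap (ResidueField A) (Cone A) (q.coeff 0)⁻¹ * (aeval T q.divX * g))
      have h3 : g = T * g1 := by
        rw [h2] at hg
        linear_combination (algebraMap (ResidueField A) (Cone A) (q.coeff 0)⁻¹) * hg - g * h1
      obtain ⟨g', hg'⟩ := ih g1 (h _ (by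
        rw [mul_left_comm, ← h3, hg]))
      exact ⟨g', by rw [h3, hg', pow_succ]; ring⟩
  rw [mem_nonZeroDivisors_iff_right]
  intro g hg
  have hqg : aeval T q * g = 0 := by
    apply hpow (f.rootMultiplicity 0)
    rw [hq, map_mul, map_pow, aeval_X] at hg
    rw [← mul_assoc, mul_comm, hg]
  refine eq_zero_of_proj fun n => ?_
  obtain ⟨g', rfl⟩ := hdiv (n + 1) g hqg
  have hTn : T ^ (n + 1) ∈ piece (maximalIdeal A) (n + 1) := by
    rw [hTdef, ← map_pow]
    exact map_mem_piece hxm (xStar_pow_mem_piece _)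
  rw [proj_mul_of_mem hTn, if_neg (by omega)]

/-- The pieces of degree at most `r` generate, since each later piece is the initial form of `x`
times the previous one. -/
theorem finite_aeval [IsNoetherianRing A] (hxm : Ideal.span {x} ≤ maximalIdeal A)
    (hr : maximalIdeal A ^ (r + 1) = Ideal.span {x} * maximalIdeal A ^ r) :
    (aeval (R := ResidueField A) (map hxm (xStar x))).toRingHom.Finite := by
  let : Algebra (ResidueField A)[X] (Cone A) :=
    (aeval (R := ResidueField A) (map hxm (xStar x))).toRingHom.toAlgebra
  change Module.Finite (ResidueField A)[X] (Cone A)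
  have hfg : ∀ n, (piece (maximalIdeal A) n).FG := fun n => by
    rw [piece, LinearMap.range_eq_map]
    exact (IsNoetherian.noetherian _).map _
  choose S hS using hfg
  have hX : ∀ g : Cone A, (X : (ResidueField A)[X]) • g = map hxm (xStar x) * g := fun g => by
    rw [Algebra.smul_def]
    exact congrArg (· * g) (aeval_X _)
  have hC : ∀ (a : A) (g : Cone A), (C (residue A a) : (ResidueField A)[X]) • g = a • g :=
    fun a g => by
      rw [Algebra.smul_def, Algebra.smul_def]
      exact congrArg (· * g) (aeval_C _ _)
  set H : Submodule (ResidueField A)[X] (Cone A) :=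
    Submodule.span _ (⋃ n ∈ Finset.range (r + 1), (S n : Set (Cone A))) with hH
  have hpiece : ∀ n, ∀ g ∈ piece (maximalIdeal A) n, g ∈ H := by
    intro n
    induction n using Nat.strong_induction_on with
    | _ n ih =>
      intro g hg
      by_cases hn : n ≤ r
      · rw [← hS n] at hg
        induction hg using Submodule.span_induction with
        | mem y hy =>
          exact Submodule.subset_span
            (Set.mem_biUnion (Finset.mem_coe.mpr (Finset.mem_range.mpr (by omega))) hy)
        | zero => exact H.zero_mem
        | add y z _ _ hy hz => exact H.add_mem hy hz
        | smul a y _ hy => rw [← hC]; exact H.smul_mem _ hy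
      · obtain ⟨m, rfl⟩ : ∃ m, n = m + 1 := ⟨n - 1, by omega⟩
        obtain ⟨h, hh, rfl⟩ := exists_eq_map_xStar_mul_of_mem_piece hxm hr (n := m) (by omega) hg
        rw [← hX]
        exact H.smul_mem _ (ih m (by omega) h hh)
  refine ⟨Submodule.fg_def.mpr ⟨_, ?_, hH.symm.trans (eq_top_iff.mpr fun g _ => ?_)⟩⟩
  · exact (Finset.range (r + 1)).finite_toSet.biUnion fun n _ => (S n).finite_toSet
  · obtain ⟨N, hN⟩ := exists_sum_proj g
    rw [hN]
    exact H.sum_mem fun n _ => hpiece n _ (proj_mem n g)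

theorem isCohenMacaulayRing_iff [IsNoetherianRing A] (hx : x ∈ A⁰)
    (hxm : Ideal.span {x} ≤ maximalIdeal A)
    (hr : maximalIdeal A ^ (r + 1) = Ideal.span {x} * maximalIdeal A ^ r) :
    IsCohenMacaulayRing (Cone A) ↔ ∀ g : Cone A, map hxm (xStar x) * g = 0 → g = 0 := by
  refine ⟨fun h => regular_of_isCohenMacaulayRing hx hxm hr h, fun h => ?_⟩
  let : Algebra (ResidueField A)[X] (Cone A) :=
    (aeval (R := ResidueField A) (map hxm (xStar x))).toRingHom.toAlgebra
  have : Algebra.IsIntegral (ResidueField A)[X] (Cone A) := ⟨(finite_aeval hxm hr).to_isIntegral⟩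
  exact isCohenMacaulayRing_of_isIntegral (P := (ResidueField A)[X]) (Polynomial.not_isField _)
    fun f hf => aeval_mem_nonZeroDivisors hxm h hf

end FiberCone

end TangentCone

end

/-! ### Interval decomposition of persistence modules. -/

noncomputable section

namespace TangentCone

universe u

section Barcode

variable {k : Type*} {M : Type u} [Field k] [AddCommGroup M] [Module k M]

/-- A finite flag of subspaces has an adapted basis. -/
theorem exists_linearIndepOn_adapted (F : ℕ → Submodule k M) (m : ℕ)
    (hF : ∀ n < m, F n ≤ F (n + 1)) :
    ∃ B : Set M, B ⊆ F m ∧ LinearIndepOn k id B ∧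
      ∀ n ≤ m, F n ≤ Submodule.span k (B ∩ F n) := by
  induction m with
  | zero =>
    obtain ⟨B, hB, -, hs, hli⟩ := exists_linearIndepOn_id_extension
      (linearIndepOn_empty k (id : M → M)) (Set.empty_subset (F 0 : Set M))
    refine ⟨B, hB, hli, fun n hn => ?_⟩
    obtain rfl : n = 0 := by omega
    rwa [Set.inter_eq_left.mpr hB]
  | succ m ih =>
    obtain ⟨B', hB', hli', hs'⟩ := ih fun n hn => hF n (by omega)
    obtain ⟨B, hB, hBB, hs, hli⟩ := exists_linearIndepOn_id_extension hli'
      (hB'.trans (hF m m.lt_succ_self))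
    refine ⟨B, hB, hli, fun n hn => ?_⟩
    by_cases hnm : n ≤ m
    · exact (hs' n hnm).trans (Submodule.span_mono (Set.inter_subset_inter_left _ hBB))
    · obtain rfl : n = m + 1 := by omega
      rwa [Set.inter_eq_left.mpr hB]

/-- A persistence module of finite-dimensional vector spaces that is eventually constant is a
direct sum of interval modules: there are finitely many elements `v s`, of degree `b s`, such that
the nonzero elements among the translates `T ^ (n - b s) (v s)` form a basis in degree `n`. -/
theorem exists_barcode (T : Module.End k M) (G : ℕ → Submodule k M)
    (hT : ∀ n, ∀ g ∈ G n, T g ∈ G (n + 1)) (hfin : ∀ n, Module.Finite k (G n)) (r : ℕ)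
    (hsurj : ∀ n, r ≤ n → ∀ g ∈ G (n + 1), ∃ h ∈ G n, g = T h)
    (hinj : ∀ n, r ≤ n → ∀ g ∈ G n, T g = 0 → g = 0) :
    ∃ (ι : Type u) (_ : Fintype ι) (b D : ι → ℕ) (v : ι → M),
      (∀ s, b s ≤ D s ∧ D s ≤ r ∧ v s ∈ G (b s) ∧ v s ≠ 0 ∧
        (D s < r → (T ^ (D s + 1 - b s)) (v s) = 0)) ∧
      (∀ n (c : ι → k), ∑ s, (if b s ≤ n ∧ (D s < r → n ≤ D s) then
          c s • (T ^ (n - b s)) (v s) else 0) = 0 →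
        ∀ s, b s ≤ n → (D s < r → n ≤ D s) → c s = 0) ∧
      ∀ n, ∀ g ∈ G n, g ∈ Submodule.span k
        {y | ∃ s, b s ≤ n ∧ (D s < r → n ≤ D s) ∧ y = (T ^ (n - b s)) (v s)} := by
  have hpow : ∀ (i j : ℕ) (g : M), (T ^ i) ((T ^ j) g) = (T ^ (i + j)) g := fun i j g => by
    rw [pow_add, Module.End.mul_apply]
  have hTpow : ∀ (m n : ℕ) (g : M), g ∈ G n → (T ^ m) g ∈ G (n + m) := by
    intro m n g hg
    induction m with
    | zero => simpa using hg
    | succ m ih =>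
      rw [pow_succ', Module.End.mul_apply]
      exact hT _ _ ih
  let S : ℕ → Submodule k M := fun D => if D < r then LinearMap.ker T else ⊤
  have hS : ∀ D g, g ∈ S D ↔ (D < r → T g = 0) := fun D g => by
    by_cases h : D < r <;> simp [S, h]
  -- `F D n` collects the possible ends at `D` of elements born by degree `n`. It grows with `n`,
  -- and a basis adapted to this flag records the births.
  let F : ℕ → ℕ → Submodule k M := fun D n => (G n).map (T ^ (D - n)) ⊓ S D
  have hF : ∀ D, ∀ n < D, F D n ≤ F D (n + 1) := by
    rintro D n hn _ ⟨⟨g, hg, rfl⟩, h2⟩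
    refine ⟨⟨T g, hT n g hg, ?_⟩, h2⟩
    rw [← Module.End.mul_apply, ← pow_succ, show D - (n + 1) + 1 = D - n by omega]
  choose B hBF hBli hBs using fun D => exists_linearIndepOn_adapted (F D) D (hF D)
  -- Each basis vector is lifted to the earliest possible degree; this minimality is what the
  -- spanning argument needs.
  have hlift : ∀ D (u : B D), ∃ n, ∃ v ∈ G n, n ≤ D ∧ (T ^ (D - n)) v = u.1 ∧
      ∀ m ≤ D, u.1 ∈ F D m → n ≤ m := by
    intro D u
    have hex : ∃ n, n ≤ D ∧ u.1 ∈ F D n := ⟨D, le_rfl, hBF D u.2⟩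
    classical
    obtain ⟨hn, ⟨v, hv, hvu⟩, -⟩ := Nat.find_spec hex
    exact ⟨Nat.find hex, v, hv, hn, hvu, fun m hm hum => Nat.find_min' hex ⟨hm, hum⟩⟩
  choose b v hvG hbD hvu hbmin using hlift
  have hSu : ∀ D (u : B D), D < r → T u.1 = 0 := fun D u => (hS D _).mp (hBF D u.2).2
  have hBfin : ∀ D, Finite (B D) := by
    intro D
    have hG : ∀ u ∈ B D, u ∈ G D := fun u hu => by
      obtain ⟨⟨g, hg, rfl⟩, -⟩ := hBF D hu
      simpa using hg
    have hli : LinearIndependent k (fun u : B D => (⟨u.1, hG u.1 u.2⟩ : G D)) :=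
      LinearIndependent.of_comp (G D).subtype (hBli D)
    have := hfin D
    exact hli.finite
  let ι : Type u := Σ D : Fin (r + 1), B D
  have : ∀ D, Fintype (B D) := fun D => Fintype.ofFinite _
  have hdie : ∀ D (u : B D), D < r → ∀ m, D < m → (T ^ (m - b D u)) (v D u) = 0 := by
    intro D u hD m hm
    have := hbD D u
    rw [show m - b D u = (m - D - 1) + (1 + (D - b D u)) by omega, ← hpow, ← hpow, hvu, pow_one,
      hSu D u hD, map_zero]
  have hindep : ∀ n ≤ r, ∀ c : ι → k, ∑ s : ι, (if b s.1 s.2 ≤ n ∧ (s.1 < r → n ≤ s.1) then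
        c s • (T ^ (n - b s.1 s.2)) (v s.1 s.2) else 0) = 0 →
      ∀ s : ι, b s.1 s.2 ≤ n → (s.1 < r → n ≤ s.1) → c s = 0 := by
    intro n hn c hc
    -- Coefficients are killed in order of decreasing end `D`. After applying `T ^ (D - n)`,
    -- intervals with an earlier end die, those with a later end already have zero coefficient, and
    -- the rest give distinct members of the basis `B D`.
    suffices ∀ e, ∀ s : ι, r - s.1 = e → b s.1 s.2 ≤ n → (s.1 < r → n ≤ s.1) → c s = 0 from
      fun s => this _ s rfl
    intro e
    induction e using Nat.strong_induction_on with
    | _ e ih =>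
      rintro ⟨D, u⟩ he hbn hDn
      simp only at he hbn hDn
      have hDr : (D : ℕ) ≤ r := by omega
      have hnD : n ≤ D := by omega
      have h1 := congrArg (T ^ ((D : ℕ) - n)) hc
      rw [map_sum, map_zero, Fintype.sum_sigma, Finset.sum_eq_single D] at h1
      · have h2 : ∑ u : B D, (if b D u ≤ n then c ⟨D, u⟩ else 0) • (id u.1 : M) = 0 := by
          rw [← h1]
          refine Finset.sum_congr rfl fun u _ => ?_
          simp only
          by_cases hu : b D u ≤ n
          · rw [if_pos hu, if_pos ⟨hu, hDn⟩, map_smul, hpow,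
              show (D : ℕ) - n + (n - b D u) = D - b D u by omega, hvu]
            rfl
          · rw [if_neg hu, if_neg (fun h => hu h.1), map_zero, zero_smul]
        have h3 := Fintype.linearIndependent_iff.mp (hBli D) _ h2 u
        rwa [if_pos hbn] at h3
      · intro D' _ hne
        refine Finset.sum_eq_zero fun u' _ => ?_
        have hDD' : (D' : ℕ) ≠ D := fun h => hne (Fin.ext h)
        split_ifs with hu'
        · rcases lt_or_gt_of_ne hDD' with hlt | hgt
          · rw [map_smul, hpow, show (D : ℕ) - n + (n - b D' u') = D - b D' u' by
              have := hu'.1; simp only at this; omega, hdie D' u' (by omega) D hlt, smul_zero]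
          · rw [ih (r - D') (by omega) ⟨D', u'⟩ rfl hu'.1 hu'.2, zero_smul, map_zero]
        · exact map_zero _
      · intro h
        exact absurd (Finset.mem_univ D) h
  have hspan : ∀ n ≤ r, ∀ g ∈ G n, g ∈ Submodule.span k
      {y | ∃ s : ι, b s.1 s.2 ≤ n ∧ (s.1 < r → n ≤ s.1) ∧
        y = (T ^ (n - b s.1 s.2)) (v s.1 s.2)} := by
    intro n hn
    set W := Submodule.span k {y | ∃ s : ι, b s.1 s.2 ≤ n ∧ (s.1 < r → n ≤ s.1) ∧
        y = (T ^ (n - b s.1 s.2)) (v s.1 s.2)} with hW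
    -- Induction on the degree `E` at which `g` is dead; `E = r + 1` imposes no condition. The image
    -- of `g` in degree `E` is matched by a combination of intervals ending at `E` and born by `n`;
    -- subtracting it makes `g` dead one degree earlier.
    suffices ∀ E, n ≤ E → E ≤ r + 1 → ∀ g ∈ G n, (E ≤ r → (T ^ (E - n)) g = 0) → g ∈ W from
      fun g hg => this (r + 1) (by omega) le_rfl g hg fun h => absurd h (by omega)
    intro E hE
    induction E, hE using Nat.le_induction with
    | base =>
      intro _ g _ h
      have := h hn
      rw [Nat.sub_self, pow_zero, Module.End.one_apply] at this
      exact this ▸ W.zero_mem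
    | succ E hE ih =>
      intro hEr g hg h
      have hgF : (T ^ (E - n)) g ∈ F E n := by
        refine ⟨⟨g, hg, rfl⟩, (hS E _).mpr fun hlt => ?_⟩
        have := h (by omega)
        rwa [show E + 1 - n = 1 + (E - n) by omega, ← hpow, pow_one] at this
      have hle : Submodule.span k (B E ∩ F E n) ≤ (W ⊓ G n).map (T ^ (E - n)) := by
        rw [Submodule.span_le]
        rintro u ⟨huB, huF⟩
        have hbn := hbmin E ⟨u, huB⟩ n hE huF
        refine ⟨(T ^ (n - b E ⟨u, huB⟩)) (v E ⟨u, huB⟩), ⟨Submodule.subset_span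
          ⟨⟨⟨E, by omega⟩, ⟨u, huB⟩⟩, hbn, fun _ => hE, rfl⟩, ?_⟩, ?_⟩
        · have := hTpow (n - b E ⟨u, huB⟩) _ _ (hvG E ⟨u, huB⟩)
          rwa [Nat.add_sub_cancel' hbn] at this
        · rw [hpow, show E - n + (n - b E ⟨u, huB⟩) = E - b E ⟨u, huB⟩ by omega, hvu]
      obtain ⟨g', ⟨hg'W, hg'G⟩, hg'⟩ := hle (hBs E n hE hgF)
      have := ih (by omega) (g - g') (Submodule.sub_mem _ hg hg'G)
        (fun _ => by rw [map_sub, hg', sub_self])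
      have h3 := W.add_mem this hg'W
      rwa [sub_add_cancel] at h3
  -- From degree `r` on the set of living intervals is constant and `T` is bijective between pieces,
  -- so independence and spanning carry over from degree `r`.
  have halive : ∀ (s : ι) n, r ≤ n →
      ((b s.1 s.2 ≤ n ∧ (s.1 < r → n ≤ s.1)) ↔ (b s.1 s.2 ≤ r ∧ (s.1 < r → r ≤ s.1))) := by
    intro s n hn
    have := hbD s.1 s.2
    have := s.1.2
    omega
  refine ⟨ι, inferInstance, fun s => b s.1 s.2, fun s => s.1, fun s => v s.1 s.2,
    fun s => ⟨hbD _ _, Nat.lt_succ_iff.mp s.1.2, hvG _ _, ?_, fun h => hdie _ _ h _ (Nat.lt_succ_self _)⟩, ?_, ?_⟩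
  · intro h0
    have := hvu s.1 s.2
    rw [show v s.1 s.2 = 0 from h0, map_zero] at this
    exact (hBli s.1).ne_zero s.2.2 this.symm
  · intro n c hc
    by_cases hn : n ≤ r
    · exact hindep n hn c hc
    · have hn' : r ≤ n := by omega
      have hinjpow : ∀ m, ∀ g ∈ G r, (T ^ m) g = 0 → g = 0 := by
        intro m
        induction m with
        | zero => intro g _ h; simpa using h
        | succ m ih =>
          intro g hg h
          rw [pow_succ', Module.End.mul_apply] at h
          exact ih g hg (hinj (r + m) (by omega) _ (hTpow m r g hg) h)
      have h1 := hinjpow (n - r) (∑ s : ι, (if b s.1 s.2 ≤ r ∧ (s.1 < r → r ≤ s.1) then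
        c s • (T ^ (r - b s.1 s.2)) (v s.1 s.2) else 0)) (Submodule.sum_mem _ fun s _ => by
          split_ifs with hs
          · refine Submodule.smul_mem _ _ ?_
            have := hTpow (r - b s.1 s.2) _ _ (hvG s.1 s.2)
            rwa [Nat.add_sub_cancel' hs.1] at this
          · exact Submodule.zero_mem _) (by
          rw [map_sum]
          refine (Finset.sum_congr rfl fun s _ => ?_).trans hc
          refine Eq.trans ?_ (if_congr (halive s n hn') rfl rfl).symm
          split_ifs with hs
          · rw [map_smul, hpow,
              show n - r + (r - b s.1 s.2) = n - b s.1 s.2 by have := hs.1; omega]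
          · exact map_zero _)
      intro s h2 h3
      obtain ⟨h4, h5⟩ := (halive s n hn').mp ⟨h2, h3⟩
      exact hindep r le_rfl c h1 s h4 h5
  · intro n
    by_cases hn : n ≤ r
    · exact hspan n hn
    · have hn' : r ≤ n := by omega
      clear hn
      induction n, hn' using Nat.le_induction with
      | base => exact hspan r le_rfl
      | succ n hn ih =>
        intro g hg
        obtain ⟨h, hh, rfl⟩ := hsurj n hn g hg
        have := Submodule.mem_map_of_mem (f := T) (ih h hh)
        rw [Submodule.map_span] at this
        refine Submodule.span_mono ?_ this
        rintro _ ⟨_, ⟨s, h1, h2, rfl⟩, rfl⟩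
        obtain ⟨h3, h4⟩ := (halive s (n + 1) (by omega)).mpr ((halive s n hn).mp ⟨h1, h2⟩)
        refine ⟨s, h3, h4, ?_⟩
        rw [Nat.sub_add_comm h1, pow_succ', Module.End.mul_apply]

end Barcode

end TangentCone

end

/-! ### From homogeneous generators to a graded isomorphism. -/

noncomputable section

namespace TangentCone

universe u

instance (r : ℕ) : Finite (TorsionIndex r) :=
  Finite.of_injective (β := Fin (r + 1) × Fin (r + 1))
    (fun p => (⟨p.1.1, by have := p.2; omega⟩, ⟨p.1.2, by have := p.2; omega⟩)) fun p q h => by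
      rw [Prod.mk.injEq, Fin.mk.injEq, Fin.mk.injEq] at h
      exact Subtype.ext (Prod.ext h.1 h.2)

instance (r : ℕ) : Fintype (TorsionIndex r) := Fintype.ofFinite _

theorem exists_equiv_sigma {κ I : Type*} [Finite κ] (f : κ → I) (α : I → ℕ)
    (hα : ∀ i, α i = Nat.card {s // f s = i}) :
    ∃ e : (Σ i, Fin (α i)) ≃ κ, ∀ s, f (e s) = s.1 := by
  refine ⟨(Equiv.sigmaCongrRight fun i =>
    (finCongr (hα i)).trans (Finite.equivFin {s // f s = i}).symm).trans
    (Equiv.sigmaFiberEquiv f), fun s => ?_⟩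
  exact ((Finite.equivFin {t // f t = s.1}).symm (finCongr (hα s.1) s.2)).2

theorem exists_quotient_lift_mul {F G : Type*} [CommRing F] [CommRing G] (J : Ideal F)
    (φ : F →+* G) (w : G) (h : ∀ f ∈ J, φ f * w = 0) :
    ∃ L : (F ⧸ J) →+ G, ∀ f, L (Ideal.Quotient.mk J f) = φ f * w :=
  ⟨QuotientAddGroup.lift J.toAddSubgroup
    ((AddMonoidHom.mulRight w).comp φ.toAddMonoidHom) h, fun _ => rfl⟩

section Decomposition

variable {A : Type u} [CommRing A] [IsLocalRing A] {x : A}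

open FiberCone

theorem FiberCone.mem_shiftedPiece_iff {I : Ideal A} {i n : ℕ} {f : FiberCone I} :
    f ∈ shiftedPiece I i n ↔ if i ≤ n then f ∈ piece I (n - i) else f = 0 := by
  rw [shiftedPiece]
  split_ifs
  · rfl
  · exact Submodule.mem_bot A

variable {r : ℕ} {α : ℕ → ℕ} {τ : ℕ → ℕ → ℕ}

/-- The formula allows arbitrary representatives `f` of the torsion coordinates, so that later
computations stay in `F(x)` instead of its quotients. -/
theorem exists_decompositionModule_hom (hxm : Ideal.span {x} ≤ maximalIdeal A)
    (u : (Σ i : Fin (r + 1), Fin (α i)) → Cone A)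
    (w : (Σ p : TorsionIndex r, Fin (τ p.1.1 p.1.2)) → Cone A)
    (hwT : ∀ s, FiberCone.map hxm (xStar x) ^ s.1.1.2 * w s = 0) :
    ∃ Φ : DecompositionModule x r α τ →+ Cone A,
      (∀ (f : NoetherNormalization x) d, Φ (f • d) = FiberCone.map hxm f * Φ d) ∧
      ∀ (d : DecompositionModule x r α τ)
        (f : (Σ p : TorsionIndex r, Fin (τ p.1.1 p.1.2)) → NoetherNormalization x),
        (∀ s, d.2 s = Ideal.Quotient.mk _ (f s)) →
        Φ d = ∑ s, FiberCone.map hxm (d.1 s) * u s + ∑ s, FiberCone.map hxm (f s) * w s := by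
  have hL : ∀ s : Σ p : TorsionIndex r, Fin (τ p.1.1 p.1.2),
      ∃ L : (NoetherNormalization x ⧸ Ideal.span {xStar x ^ s.1.1.2}) →+ Cone A,
        ∀ f, L (Ideal.Quotient.mk _ f) = FiberCone.map hxm f * w s := fun s =>
    exists_quotient_lift_mul _ _ _ fun f hf => by
      obtain ⟨g, rfl⟩ := Ideal.mem_span_singleton'.mp hf
      rw [map_mul, map_pow, mul_assoc, hwT, mul_zero]
  choose L hL using hL
  let Φ : DecompositionModule x r α τ →+ Cone A :=
    AddMonoidHom.coprod
      (∑ s, ((AddMonoidHom.mulRight (u s)).comp (FiberCone.map hxm).toAddMonoidHom).comp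
        (Pi.evalAddMonoidHom _ s))
      (∑ s, (L s).comp (Pi.evalAddMonoidHom _ s))
  have hΦ : ∀ (d : DecompositionModule x r α τ)
      (f : (Σ p : TorsionIndex r, Fin (τ p.1.1 p.1.2)) → NoetherNormalization x),
      (∀ s, d.2 s = Ideal.Quotient.mk _ (f s)) →
      Φ d = ∑ s, FiberCone.map hxm (d.1 s) * u s + ∑ s, FiberCone.map hxm (f s) * w s := by
    intro d f hf
    rw [AddMonoidHom.coprod_apply, AddMonoidHom.finsetSum_apply, AddMonoidHom.finsetSum_apply]
    congr 1
    refine Finset.sum_congr rfl fun s _ => ?_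
    rw [← hL, ← hf s]
    rfl
  refine ⟨Φ, fun f d => ?_, hΦ⟩
  choose g hg using fun s => Ideal.Quotient.mk_surjective (d.2 s)
  rw [hΦ d g fun s => (hg s).symm, hΦ (f • d) (fun s => f * g s) fun s => by
    rw [Prod.smul_snd, Pi.smul_apply, ← hg s, map_mul]
    rfl, mul_add, Finset.mul_sum, Finset.mul_sum]
  congr 1
  · exact Finset.sum_congr rfl fun s _ => by
      rw [Prod.smul_fst, Pi.smul_apply, smul_eq_mul, map_mul, mul_assoc]
  · exact Finset.sum_congr rfl fun s _ => by rw [map_mul, mul_assoc]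

/-- `hind` and `hspan` say that the surviving translates of the generators form a basis in each
degree over the residue field. This gives bijectivity degree by degree, and taking homogeneous
components makes it global. -/
theorem isHomogeneous_decomposition (hxm : Ideal.span {x} ≤ maximalIdeal A)
    (u : (Σ i : Fin (r + 1), Fin (α i)) → Cone A)
    (w : (Σ p : TorsionIndex r, Fin (τ p.1.1 p.1.2)) → Cone A)
    (hu : ∀ s, u s ∈ piece (maximalIdeal A) s.1)
    (hw : ∀ s, w s ∈ piece (maximalIdeal A) s.1.1.1)
    (hwT : ∀ s, FiberCone.map hxm (xStar x) ^ s.1.1.2 * w s = 0)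
    (hind : ∀ n (c : _ → ResidueField A) (d : _ → ResidueField A),
      ∑ s, (if (s.1 : ℕ) ≤ n then
          c s • (FiberCone.map hxm (xStar x) ^ (n - s.1 : ℕ) * u s) else 0) +
        ∑ s, (if s.1.1.1 ≤ n ∧ n < s.1.1.1 + s.1.1.2 then
          d s • (FiberCone.map hxm (xStar x) ^ (n - s.1.1.1) * w s) else 0) = 0 →
      (∀ s, (s.1 : ℕ) ≤ n → c s = 0) ∧
        ∀ s, s.1.1.1 ≤ n → n < s.1.1.1 + s.1.1.2 → d s = 0)
    (hspan : ∀ n, ∀ g ∈ piece (maximalIdeal A) n, g ∈ Submodule.span (ResidueField A)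
      {y | (∃ s m, y = FiberCone.map hxm (xStar x) ^ m * u s) ∨
        ∃ s m, y = FiberCone.map hxm (xStar x) ^ m * w s}) :
    ∃ e : Cone A ≃+ DecompositionModule x r α τ,
      (∀ (f : NoetherNormalization x) (g : Cone A), e (FiberCone.map hxm f * g) = f • e g) ∧
        ∀ (n : ℕ) (g : Cone A),
          g ∈ piece (maximalIdeal A) n ↔ IsHomogeneousOfDegree n (e g) := by
  obtain ⟨Φ, hΦs, hΦ⟩ := exists_decompositionModule_hom hxm u w hwT
  have hmapT : ∀ (a : A) (m : ℕ), FiberCone.map hxm (a • xStar x ^ m) =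
      a • FiberCone.map hxm (xStar x) ^ m := fun a m => by
    rw [FiberCone.map_smul_base, map_pow]
  -- homogeneous elements of the kernel vanish
  have hker : ∀ n d, IsHomogeneousOfDegree n d → Φ d = 0 → d = 0 := by
    rintro n d ⟨h1, h2⟩ hd
    choose f hf hfd using h2
    rw [hΦ d f hfd] at hd
    have h1' : ∀ s, ∃ a : A, if (s.1 : ℕ) ≤ n then d.1 s = a • xStar x ^ (n - s.1 : ℕ)
        else d.1 s = 0 := fun s => by
      have := mem_shiftedPiece_iff.mp (h1 s)
      split_ifs at this ⊢
      · exact mem_piece_span_iff.mp this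
      · exact ⟨0, this⟩
    have h2' : ∀ s, ∃ a : A, if s.1.1.1 ≤ n then f s = a • xStar x ^ (n - s.1.1.1)
        else f s = 0 := fun s => by
      have := mem_shiftedPiece_iff.mp (hf s)
      split_ifs at this ⊢
      · exact mem_piece_span_iff.mp this
      · exact ⟨0, this⟩
    choose a ha using h1'
    choose c hc using h2'
    obtain ⟨h3, h4⟩ := hind n (fun s => residue A (a s)) (fun s => residue A (c s)) (by
      refine Eq.trans ?_ hd
      congr 1
      · refine Finset.sum_congr rfl fun s _ => ?_
        have := ha s
        split_ifs at this ⊢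
        · rw [this, hmapT, residue_smul, smul_mul_assoc]
        · rw [this, map_zero, zero_mul]
      · refine Finset.sum_congr rfl fun s _ => ?_
        have := hc s
        by_cases hin : s.1.1.1 ≤ n
        · rw [if_pos hin] at this
          rw [this, hmapT]
          by_cases hnj : n < s.1.1.1 + s.1.1.2
          · rw [if_pos ⟨hin, hnj⟩, residue_smul, smul_mul_assoc]
          · rw [if_neg (fun h => hnj h.2), smul_mul_assoc,
              show n - s.1.1.1 = (n - s.1.1.1 - s.1.1.2) + s.1.1.2 by omega, pow_add,
              mul_assoc, hwT, mul_zero, smul_zero]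
        · rw [if_neg hin] at this
          rw [if_neg (fun h => hin h.1), this, map_zero, zero_mul])
    refine Prod.ext (funext fun s => ?_) (funext fun s => ?_)
    · have := ha s
      split_ifs at this with hs
      · rw [this]
        exact smul_eq_zero_of_mem ((residue_eq_zero_iff _).mp (h3 s hs)) _
      · exact this
    · rw [hfd s]
      refine Ideal.Quotient.eq_zero_iff_mem.mpr ?_
      have := hc s
      split_ifs at this with hs
      · rw [this]
        by_cases hnj : n < s.1.1.1 + s.1.1.2
        · rw [smul_eq_zero_of_mem ((residue_eq_zero_iff _).mp (h4 s hs hnj))]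
          exact Ideal.zero_mem _
        · rw [show n - s.1.1.1 = (n - s.1.1.1 - s.1.1.2) + s.1.1.2 by omega, pow_add,
            ← smul_mul_assoc]
          exact Ideal.mul_mem_left _ _ (Ideal.mem_span_singleton_self _)
      · rw [this]
        exact Ideal.zero_mem _
  -- homogeneous components
  have hcomp : ∀ d : DecompositionModule x r α τ, ∃ h : ℕ → DecompositionModule x r α τ,
      (∀ n, IsHomogeneousOfDegree n (h n)) ∧
      (∀ n, Φ (h n) = FiberCone.proj (maximalIdeal A) n (Φ d)) ∧ ((∀ n, h n = 0) → d = 0) := by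
    intro d
    choose f hf using fun s => Ideal.Quotient.mk_surjective (d.2 s)
    have hΦd := hΦ d f fun s => (hf s).symm
    refine ⟨fun n => (fun s => if (s.1 : ℕ) ≤ n then FiberCone.proj _ (n - s.1 : ℕ) (d.1 s) else 0,
      fun s => Ideal.Quotient.mk _ (if s.1.1.1 ≤ n then FiberCone.proj _ (n - s.1.1.1) (f s)
        else 0)), fun n => ⟨fun s => ?_, fun s => ⟨_, ?_, rfl⟩⟩, fun n => ?_, fun h => ?_⟩
    · rw [mem_shiftedPiece_iff]
      split_ifs with hs
      · simp only [if_pos hs]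
        exact proj_mem _ _
      · simp only [if_neg hs]
    · rw [mem_shiftedPiece_iff]
      split_ifs with hs
      · exact proj_mem _ _
      · rfl
    · rw [hΦ _ _ fun s => rfl, hΦd, map_add, map_sum, map_sum]
      congr 1
      · refine Finset.sum_congr rfl fun s _ => ?_
        rw [proj_mul_of_mem (hu s), proj_map]
        dsimp only
        split_ifs
        · rfl
        · rw [map_zero, zero_mul]
      · refine Finset.sum_congr rfl fun s _ => ?_
        rw [proj_mul_of_mem (hw s), proj_map]
        split_ifs
        · rfl
        · rw [map_zero, zero_mul]
    · refine Prod.ext (funext fun s => ?_) (funext fun s => ?_)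
      · refine eq_zero_of_proj fun m => ?_
        have := congrFun (congrArg Prod.fst (h (m + s.1))) s
        simp only [if_pos (Nat.le_add_left _ _), Nat.add_sub_cancel] at this
        exact this
      · rw [← hf s]
        obtain ⟨N, hN⟩ := exists_sum_proj (f s)
        rw [hN, map_sum]
        refine Finset.sum_eq_zero fun m _ => ?_
        have := congrFun (congrArg Prod.snd (h (m + s.1.1.1))) s
        simp only [if_pos (Nat.le_add_left _ _), Nat.add_sub_cancel] at this
        exact this
  have hinj : Function.Injective Φ := by
    rw [injective_iff_map_eq_zero]
    intro d hd
    obtain ⟨h, h1, h2, h3⟩ := hcomp d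
    exact h3 fun n => hker n _ (h1 n) (by rw [h2, hd, map_zero])
  have hsurj : Function.Surjective Φ := by
    have hgen : ∀ y ∈ {y | (∃ s m, y = FiberCone.map hxm (xStar x) ^ m * u s) ∨
        ∃ s m, y = FiberCone.map hxm (xStar x) ^ m * w s}, ∃ d, Φ d = y := by
      classical
      rintro y (⟨s, m, rfl⟩ | ⟨s, m, rfl⟩)
      · refine ⟨(Pi.single s (xStar x ^ m), 0), ?_⟩
        rw [hΦ _ (fun _ => 0) fun s => (map_zero _).symm, Finset.sum_eq_single s]
        · simp [map_pow]
        · intro t _ hts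
          simp [Pi.single_eq_of_ne hts]
        · intro h
          exact absurd (Finset.mem_univ s) h
      · refine ⟨(0, fun t => Ideal.Quotient.mk _
          ((Pi.single s (xStar x ^ m) : _ → NoetherNormalization x) t)), ?_⟩
        rw [hΦ _ _ fun s => rfl, add_comm, Finset.sum_eq_single s]
        · simp [map_pow]
        · intro t _ hts
          simp [Pi.single_eq_of_ne hts]
        · intro h
          exact absurd (Finset.mem_univ s) h
    intro g
    obtain ⟨N, hN⟩ := exists_sum_proj g
    have hpiece : ∀ n, ∃ d, Φ d = FiberCone.proj (maximalIdeal A) n g := fun n => by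
      have := hspan n _ (proj_mem n g)
      generalize FiberCone.proj (maximalIdeal A) n g = y at this
      induction this using Submodule.span_induction with
      | mem y hy => exact hgen y hy
      | zero => exact ⟨0, map_zero _⟩
      | add y z _ _ hy hz =>
        obtain ⟨d, hd⟩ := hy
        obtain ⟨d', hd'⟩ := hz
        exact ⟨d + d', by rw [map_add, hd, hd']⟩
      | smul c y _ hy =>
        obtain ⟨d, hd⟩ := hy
        obtain ⟨a, rfl⟩ := residue_surjective c
        refine ⟨algebraMap A (NoetherNormalization x) a • d, ?_⟩
        rw [hΦs, map_algebraMap, hd, residue_smul, Algebra.smul_def]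
    choose d hd using hpiece
    exact ⟨∑ n ∈ Finset.range N, d n, by
      rw [map_sum, Finset.sum_congr rfl fun n _ => hd n, ← hN]⟩
  have hhom : ∀ n d, IsHomogeneousOfDegree n d ↔ Φ d ∈ piece (maximalIdeal A) n := by
    intro n d
    obtain ⟨h, h1, h2, h3⟩ := hcomp d
    constructor
    · rintro ⟨h1, h2⟩
      choose f hf hfd using h2
      rw [hΦ d f hfd]
      refine Submodule.add_mem _ (Submodule.sum_mem _ fun s _ => ?_)
        (Submodule.sum_mem _ fun s _ => ?_)
      · have := mem_shiftedPiece_iff.mp (h1 s)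
        split_ifs at this with hs
        · rw [← Nat.sub_add_cancel hs]
          exact mul_mem_piece (map_mem_piece hxm this) (hu s)
        · rw [this, map_zero, zero_mul]
          exact Submodule.zero_mem _
      · have := mem_shiftedPiece_iff.mp (hf s)
        split_ifs at this with hs
        · rw [← Nat.sub_add_cancel hs]
          exact mul_mem_piece (map_mem_piece hxm this) (hw s)
        · rw [this, map_zero, zero_mul]
          exact Submodule.zero_mem _
    -- The degree `n` component of `d` has the same image as `d`, so it equals `d` by injectivity.
    · intro hd
      rw [mem_piece_iff_proj, ← h2] at hd
      exact hinj hd ▸ h1 n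
  let e := (AddEquiv.ofBijective Φ ⟨hinj, hsurj⟩).symm
  have hΦe : ∀ g, Φ (e g) = g := fun g => 
    AddEquiv.apply_symm_apply (AddEquiv.ofBijective Φ ⟨hinj, hsurj⟩) g
  refine ⟨e, fun f g => hinj ?_, fun n g => ?_⟩
  · rw [hΦe, hΦs, hΦe]
  · rw [hhom, hΦe]

end Decomposition

end TangentCone

end

/-! ### Existence of the decomposition. -/

noncomputable section

namespace TangentCone

universe u

section Existence

variable {A : Type u} [CommRing A] [IsLocalRing A] {x : A} {r : ℕ}

open FiberCone

/-- The homogeneous component of degree `n` as a vector space over the residue field. -/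
def FiberCone.residuePiece (I : Ideal A) (n : ℕ) : Submodule (ResidueField A) (FiberCone I) where
  carrier := piece I n
  add_mem' := (piece I n).add_mem
  zero_mem' := (piece I n).zero_mem
  smul_mem' c g hg := by
    obtain ⟨a, rfl⟩ := residue_surjective c
    rw [residue_smul]
    exact (piece I n).smul_mem a hg

instance [IsNoetherianRing A] (I : Ideal A) (n : ℕ) :
    Module.Finite (ResidueField A) (residuePiece I n) := by
  have h : Module.Finite A (residuePiece I n) :=
    Module.Finite.of_surjective (M := ↥(I ^ n)) (P := residuePiece I n)
      ((of I n).codRestrict ((residuePiece I n).restrictScalars A) fun c => of_mem_piece n c)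
      fun ⟨g, c, hc⟩ => ⟨c, Subtype.ext hc⟩
  exact Module.Finite.of_restrictScalars_finite A (ResidueField A) _

/-- For `n ≥ r`, `x c ∈ 𝔪 ^ (n+2) = x 𝔪 ^ (n+1)`, and cancelling `x` raises the order of `c`. This
is the injectivity needed for the interval decomposition. -/
theorem eq_zero_of_map_xStar_mul_of_mem_piece [IsNoetherianRing A] (hx : x ∈ A⁰)
    (hxm : Ideal.span {x} ≤ maximalIdeal A)
    (hr : maximalIdeal A ^ (r + 1) = Ideal.span {x} * maximalIdeal A ^ r) {n : ℕ} (hn : r ≤ n)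
    {g : Cone A} (hg : g ∈ piece (maximalIdeal A) n)
    (h : FiberCone.map hxm (xStar x) * g = 0) : g = 0 := by
  obtain ⟨⟨c, hc⟩, rfl⟩ := hg
  rw [map_xStar_mul_of, maximalIdeal_pow_succ_eq hr (by omega)] at h
  obtain ⟨d, hd, hdc⟩ := Ideal.mem_span_singleton_mul.mp h
  rw [of_eq_zero_iff, ← pow_succ', ← (mul_cancel_left_mem_nonZeroDivisors hx).mp hdc]
  exact hd

theorem eq_zero_of_map_xStar_pow_mul_of_mem_piece_zero [IsNoetherianRing A] (hx : x ∈ A⁰)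
    (hxm : Ideal.span {x} ≤ maximalIdeal A)
    (hr : maximalIdeal A ^ (r + 1) = Ideal.span {x} * maximalIdeal A ^ r) {g : Cone A}
    (hg : g ∈ piece (maximalIdeal A) 0) (m : ℕ)
    (h : FiberCone.map hxm (xStar x) ^ m * g = 0) : g = 0 := by
  obtain ⟨⟨a, ha⟩, rfl⟩ := hg
  rw [← algebraMap_eq_of (I := maximalIdeal A) a] at h ⊢
  rw [mul_comm, ← Algebra.smul_def, smul_map_xStar_pow_eq_zero_iff hx hxm hr] at h
  rw [Algebra.algebraMap_eq_smul_one]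
  exact smul_eq_zero_of_mem h 1

/-- The intervals of the cone under the initial form of `x` are the summands: those with `D = r` are
free, and those with `D < r` are torsion of length `D + 1 - b`, whence `b + (D + 1 - b) ≤ r`. -/
theorem exists_decomposition [IsNoetherianRing A] (hx : x ∈ A⁰)
    (hxm : Ideal.span {x} ≤ maximalIdeal A)
    (hr : maximalIdeal A ^ (r + 1) = Ideal.span {x} * maximalIdeal A ^ r) :
    ∃ (α : ℕ → ℕ) (τ : ℕ → ℕ → ℕ), ∃ e : Cone A ≃+ DecompositionModule x r α τ,
      (∀ (f : NoetherNormalization x) (g : Cone A), e (FiberCone.map hxm f * g) = f • e g) ∧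
        ∀ (n : ℕ) (g : Cone A),
          g ∈ piece (maximalIdeal A) n ↔ IsHomogeneousOfDegree n (e g) := by
  set T := FiberCone.map hxm (xStar x) with hT
  have hTpiece : T ∈ piece (maximalIdeal A) 1 := map_mem_piece hxm xStar_mem_piece
  have hpow : ∀ (m : ℕ) (g : Cone A),
      (LinearMap.mulLeft (ResidueField A) T ^ m) g = T ^ m * g := fun m g => by
    rw [LinearMap.pow_mulLeft, LinearMap.mulLeft_apply]
  obtain ⟨ι, _, b, D, v, hv, hind, hspan⟩ := exists_barcode
    (LinearMap.mulLeft (ResidueField A) T) (residuePiece (maximalIdeal A))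
    (fun n g hg => by
      change T * g ∈ piece (maximalIdeal A) (n + 1)
      rw [add_comm]
      exact mul_mem_piece hTpiece hg)
    inferInstance r
    (fun n hn g hg => exists_eq_map_xStar_mul_of_mem_piece hxm hr hn hg)
    (fun n hn g hg h => eq_zero_of_map_xStar_mul_of_mem_piece hx hxm hr hn hg h)
  simp only [hpow] at hv hind hspan
  -- Degree zero is the residue field, on which no power of the initial form of `x` vanishes; hence
  -- torsion starts in degree at least one.
  have hb : ∀ s, D s ≠ r → 1 ≤ b s := fun s hs => by
    obtain ⟨h1, h2, h3, h4, h5⟩ := hv s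
    by_contra hb0
    have hb0' : b s = 0 := by omega
    rw [hb0'] at h3
    exact h4 (eq_zero_of_map_xStar_pow_mul_of_mem_piece_zero hx hxm hr h3 _ (h5 (by omega)))
  obtain ⟨E₁, hE₁⟩ := exists_equiv_sigma
    (fun s : {s // D s = r} => (⟨b s, by have := hv s; omega⟩ : Fin (r + 1)))
    (fun i => Nat.card {s : {s // D s = r} // b s = i})
    (fun i => Nat.card_congr (Equiv.subtypeEquivRight fun s => by rw [Fin.ext_iff]))
  obtain ⟨E₂, hE₂⟩ := exists_equiv_sigma
    (fun s : {s // ¬ D s = r} => (⟨(b s, D s + 1 - b s), by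
      have := hv s; have := hb s s.2; have := s.2; simp only; omega⟩ : TorsionIndex r))
    (fun p => Nat.card {s : {s // ¬ D s = r} // b s = p.1.1 ∧ D s + 1 - b s = p.1.2})
    (fun p => Nat.card_congr (Equiv.subtypeEquivRight fun s => by
      rw [Subtype.ext_iff, Prod.ext_iff]))
  refine ⟨fun i => Nat.card {s : {s // D s = r} // b s = i},
    fun i j => Nat.card {s : {s // ¬ D s = r} // b s = i ∧ D s + 1 - b s = j}, ?_⟩
  have hb₁ : ∀ s, b (E₁ s) = s.1 := fun s => congrArg Fin.val (hE₁ s)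
  have hb₂ : ∀ s, b (E₂ s) = s.1.1.1 := fun s => congrArg (fun p => p.1.1) (hE₂ s)
  have hD₂ : ∀ s, D (E₂ s) + 1 - b (E₂ s) = s.1.1.2 := fun s =>
    congrArg (fun p => p.1.2) (hE₂ s)
  refine isHomogeneous_decomposition hxm (fun s => v (E₁ s)) (fun s => v (E₂ s)) ?_ ?_ ?_ ?_ ?_
  · intro s
    rw [← hb₁ s]
    exact (hv _).2.2.1
  · intro s
    rw [← hb₂ s]
    exact (hv _).2.2.1
  · intro s
    rw [← hD₂ s]
    have := (E₂ s).2
    obtain ⟨h1, h2, h3, h4, h5⟩ := hv (E₂ s)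
    exact h5 (by omega)
  · intro n c d hcd
    classical
    let C : ι → ResidueField A := fun s =>
      if h : D s = r then c (E₁.symm ⟨s, h⟩) else d (E₂.symm ⟨s, h⟩)
    have hC₁ : ∀ s, C (E₁ s) = c s := fun s => by
      simp only [C, dif_pos (E₁ s).2, Subtype.coe_eta, Equiv.symm_apply_apply]
    have hC₂ : ∀ s, C (E₂ s) = d s := fun s => by
      simp only [C, dif_neg (E₂ s).2, Subtype.coe_eta, Equiv.symm_apply_apply]
    have halive₂ : ∀ s, (b (E₂ s) ≤ n ∧ (D (E₂ s) < r → n ≤ D (E₂ s))) ↔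
        (s.1.1.1 ≤ n ∧ n < s.1.1.1 + s.1.1.2) := fun s => by
      have := hb₂ s
      have := hD₂ s
      have := (E₂ s).2
      have := hv (E₂ s)
      omega
    have hzero := hind n C (by
      rw [← (Equiv.sumCompl fun s => D s = r).sum_comp, Fintype.sum_sum_type, ← E₁.sum_comp,
        ← E₂.sum_comp]
      refine Eq.trans ?_ hcd
      congr 1
      · refine Finset.sum_congr rfl fun s _ => ?_
        rw [Equiv.sumCompl_apply_inl, hC₁, hb₁, (E₁ s).2]
        exact if_congr (and_iff_left fun h => absurd h (lt_irrefl r)) rfl rfl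
      · refine Finset.sum_congr rfl fun s _ => ?_
        rw [Equiv.sumCompl_apply_inr, hC₂, if_congr (halive₂ s) rfl rfl, hb₂])
    refine ⟨fun s hs => ?_, fun s h1 h2 => ?_⟩
    · rw [← hC₁]
      refine hzero _ (hb₁ s ▸ hs) fun h => ?_
      rw [(E₁ s).2] at h
      exact absurd h (lt_irrefl r)
    · rw [← hC₂]
      obtain ⟨h3, h4⟩ := (halive₂ s).mpr ⟨h1, h2⟩
      exact hzero _ h3 h4
  · intro n g hg
    refine Submodule.span_mono ?_ (hspan n g hg)
    rintro y ⟨s, h1, h2, rfl⟩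
    by_cases hs : D s = r
    · exact Or.inl ⟨E₁.symm ⟨s, hs⟩, _, by rw [Equiv.apply_symm_apply]⟩
    · exact Or.inr ⟨E₂.symm ⟨s, hs⟩, _, by rw [Equiv.apply_symm_apply]⟩

end Existence

end TangentCone

end

/-! ### Hilbert function and torsion of a decomposition. -/

noncomputable section

namespace TangentCone

universe u

section Length

variable {A : Type u} [CommRing A] [IsLocalRing A]

theorem length_eq_one_of_forall_smul {M : Type*} [AddCommGroup M] [Module A M] {P : Submodule A M}
    {y : M} (hP : ∀ g, g ∈ P ↔ ∃ a : A, g = a • y)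
    (hy : ∀ a : A, a • y = 0 ↔ a ∈ maximalIdeal A) : Module.length A P = 1 := by
  have h1 : P = Submodule.span A {y} := by
    ext g
    rw [hP, Submodule.mem_span_singleton]
    exact exists_congr fun a => eq_comm
  have h2 : Ideal.torsionOf A M y = maximalIdeal A := by
    ext a
    rw [Ideal.mem_torsionOf_iff, hy]
  have h3 : IsSimpleModule A (A ⧸ maximalIdeal A) :=
    isSimpleModule_iff_isCoatom.mpr (maximalIdeal.isMaximal A).out
  rw [h1, ← (Ideal.quotTorsionOfEquivSpanSingleton A M y).length_eq, h2]
  exact Module.length_eq_one A _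

open FiberCone

theorem FiberCone.length_piece (n : ℕ) :
    Module.length A (piece (maximalIdeal A) n) =
      eRelLength (maximalIdeal A ^ n) (maximalIdeal A ^ (n + 1)) := by
  rw [piece, ← (LinearMap.quotKerEquivRange (of (maximalIdeal A) n)).length_eq]
  refine (Submodule.quotEquivOfEq _ _ ?_).length_eq
  ext c
  rw [LinearMap.mem_ker, of_eq_zero_iff, ← pow_succ']
  rfl

variable {x : A} {r : ℕ} [IsNoetherianRing A]

theorem smul_xStar_pow_eq_zero_iff (hx : x ∈ A⁰) (hxm : Ideal.span {x} ≤ maximalIdeal A)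
    (hr : maximalIdeal A ^ (r + 1) = Ideal.span {x} * maximalIdeal A ^ r) (n : ℕ) (a : A) :
    a • xStar x ^ n = 0 ↔ a ∈ maximalIdeal A := by
  refine ⟨fun h => ?_, fun h => smul_eq_zero_of_mem h _⟩
  have := congrArg (FiberCone.map hxm) h
  rwa [FiberCone.map_smul_base, map_pow, map_zero, smul_map_xStar_pow_eq_zero_iff hx hxm hr] at this

/-- The ideal generated by the `j`-th power of `x⋆` has nothing in degrees below `j`, so the
quotient changes nothing there. -/
theorem smul_mk_xStar_pow_eq_zero_iff (hx : x ∈ A⁰) (hxm : Ideal.span {x} ≤ maximalIdeal A)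
    (hr : maximalIdeal A ^ (r + 1) = Ideal.span {x} * maximalIdeal A ^ r) {n j : ℕ} (hn : n < j)
    (a : A) : a • Ideal.Quotient.mk (Ideal.span {xStar x ^ j}) (xStar x ^ n) = 0 ↔
      a ∈ maximalIdeal A := by
  rw [← smul_xStar_pow_eq_zero_iff hx hxm hr n a]
  change Ideal.Quotient.mk (Ideal.span {xStar x ^ j}) (a • xStar x ^ n) = 0 ↔ _
  rw [Ideal.Quotient.eq_zero_iff_mem]
  constructor
  · intro h
    obtain ⟨f, hf⟩ := Ideal.mem_span_singleton'.mp h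
    have h1 := proj_mul_of_mem (xStar_pow_mem_piece (x := x) j) f n
    rwa [if_neg (by omega), hf, map_smul, proj_of_mem (xStar_pow_mem_piece n), if_pos rfl] at h1
  · intro h
    rw [h]
    exact Ideal.zero_mem _

theorem length_shiftedPiece (hx : x ∈ A⁰) (hxm : Ideal.span {x} ≤ maximalIdeal A)
    (hr : maximalIdeal A ^ (r + 1) = Ideal.span {x} * maximalIdeal A ^ r) (i n : ℕ) :
    Module.length A (shiftedPiece (Ideal.span {x}) i n) = if i ≤ n then 1 else 0 := by
  by_cases hi : i ≤ n
  · rw [shiftedPiece, if_pos hi, if_pos hi]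
    exact length_eq_one_of_forall_smul (fun g => mem_piece_span_iff)
      (smul_xStar_pow_eq_zero_iff hx hxm hr (n - i))
  · rw [shiftedPiece, if_neg hi, if_neg hi]
    exact Module.length_bot

theorem length_map_shiftedPiece (hx : x ∈ A⁰) (hxm : Ideal.span {x} ≤ maximalIdeal A)
    (hr : maximalIdeal A ^ (r + 1) = Ideal.span {x} * maximalIdeal A ^ r) (i j n : ℕ) :
    Module.length A ((shiftedPiece (Ideal.span {x}) i n).map
        (Ideal.Quotient.mkₐ A (Ideal.span {xStar x ^ j})).toLinearMap) =
      if i ≤ n ∧ n < i + j then 1 else 0 := by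
  rw [shiftedPiece]
  by_cases hi : i ≤ n
  · rw [if_pos hi]
    by_cases hj : n < i + j
    · rw [if_pos ⟨hi, hj⟩]
      refine length_eq_one_of_forall_smul (fun g => ?_)
        (smul_mk_xStar_pow_eq_zero_iff hx hxm hr (n := n - i) (j := j) (by omega))
      constructor
      · rintro ⟨f, hf, rfl⟩
        obtain ⟨a, rfl⟩ := mem_piece_span_iff.mp hf
        exact ⟨a, rfl⟩
      · rintro ⟨a, rfl⟩
        exact ⟨_, mem_piece_span_iff.mpr ⟨a, rfl⟩, rfl⟩
    · rw [if_neg (fun h => hj h.2), Module.length_eq_zero_iff, Submodule.subsingleton_iff_eq_bot,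
        eq_bot_iff, Submodule.map_le_iff_le_comap]
      intro f hf
      obtain ⟨a, rfl⟩ := mem_piece_span_iff.mp hf
      refine Ideal.Quotient.eq_zero_iff_mem.mpr ?_
      rw [show n - i = (n - i - j) + j by omega, pow_add, ← smul_mul_assoc]
      exact Ideal.mul_mem_left _ _ (Ideal.mem_span_singleton_self _)
  · rw [if_neg hi, if_neg (fun h => hi h.1), Submodule.map_bot]
    exact Module.length_bot

variable {α : ℕ → ℕ} {τ : ℕ → ℕ → ℕ} {e : Cone A ≃+ DecompositionModule x r α τ}

/-- The Hilbert function of the tangent cone in terms of a decomposition. -/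
theorem hilbert_eq_of_decomposition (hx : x ∈ A⁰) (hxm : Ideal.span {x} ≤ maximalIdeal A)
    (hr : maximalIdeal A ^ (r + 1) = Ideal.span {x} * maximalIdeal A ^ r)
    (he : ∀ (f : NoetherNormalization x) (g : Cone A), e (FiberCone.map hxm f * g) = f • e g)
    (hn : ∀ (n : ℕ) (g : Cone A), g ∈ piece (maximalIdeal A) n ↔ IsHomogeneousOfDegree n (e g))
    (n : ℕ) :
    relLength (maximalIdeal A ^ n) (maximalIdeal A ^ (n + 1)) =
      ∑ s : Σ i : Fin (r + 1), Fin (α i), (if (s.1 : ℕ) ≤ n then 1 else 0) +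
        ∑ s : Σ p : TorsionIndex r, Fin (τ p.1.1 p.1.2),
          (if s.1.1.1 ≤ n ∧ n < s.1.1.1 + s.1.1.2 then 1 else 0) := by
  -- `A` acts on both sides through the degree zero part of `F(x)`, so `e` preserves lengths over
  -- `A`.
  have hsmul : ∀ (a : A) g, e (a • g) = a • e g := fun a g => by
    rw [Algebra.smul_def, ← map_algebraMap hxm, he]
    refine Prod.ext (funext fun s => ?_) (funext fun s => ?_)
    · exact (Algebra.smul_def a ((e g).1 s)).symm
    · exact algebraMap_smul (NoetherNormalization x) a ((e g).2 s)
  let φ : piece (maximalIdeal A) n →ₗ[A]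
      ((s : Σ i : Fin (r + 1), Fin (α i)) → shiftedPiece (Ideal.span {x}) s.1 n) ×
      ((s : Σ p : TorsionIndex r, Fin (τ p.1.1 p.1.2)) →
        (shiftedPiece (Ideal.span {x}) s.1.1.1 n).map
          (Ideal.Quotient.mkₐ A (Ideal.span {xStar x ^ s.1.1.2})).toLinearMap) :=
    { toFun := fun g => (fun s => ⟨(e g).1 s, ((hn n g).mp g.2).1 s⟩,
        fun s => ⟨(e g).2 s, by
          obtain ⟨f, hf, h⟩ := ((hn n g).mp g.2).2 s
          exact ⟨f, hf, h.symm⟩⟩)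
      map_add' := fun g h => by
        refine Prod.ext (funext fun s => Subtype.ext ?_) (funext fun s => Subtype.ext ?_)
        · change (e (g + h)).1 s = (e g).1 s + (e h).1 s
          rw [map_add]
          rfl
        · change (e (g + h)).2 s = (e g).2 s + (e h).2 s
          rw [map_add]
          rfl
      map_smul' := fun a g => by
        refine Prod.ext (funext fun s => Subtype.ext ?_) (funext fun s => Subtype.ext ?_)
        · change (e (a • g)).1 s = a • (e g).1 s
          rw [hsmul]
          rfl
        · change (e (a • g)).2 s = a • (e g).2 s
          rw [hsmul]
          rfl }
  have hφ : Function.Bijective φ := by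
    constructor
    · intro g h hgh
      refine Subtype.ext (e.injective (Prod.ext (funext fun s => ?_) (funext fun s => ?_)))
      · exact congrArg Subtype.val (congrFun (congrArg Prod.fst hgh) s)
      · exact congrArg Subtype.val (congrFun (congrArg Prod.snd hgh) s)
    · rintro ⟨d₁, d₂⟩
      refine ⟨⟨e.symm (fun s => d₁ s, fun s => d₂ s), (hn n _).mpr ?_⟩, ?_⟩
      · rw [e.apply_symm_apply]
        refine ⟨fun s => (d₁ s).2, fun s => ?_⟩
        obtain ⟨f, hf, h⟩ := (d₂ s).2
        exact ⟨f, hf, h.symm⟩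
      · refine Prod.ext (funext fun s => Subtype.ext ?_) (funext fun s => Subtype.ext ?_)
        · change (e (e.symm _)).1 s = _
          rw [e.apply_symm_apply]
        · change (e (e.symm _)).2 s = _
          rw [e.apply_symm_apply]
  have hlen := (LinearEquiv.ofBijective φ hφ).length_eq
  rw [FiberCone.length_piece, Module.length_prod, Module.length_pi_of_fintype,
    Module.length_pi_of_fintype, Finset.sum_congr rfl fun (s : Σ i : Fin (r + 1), Fin (α i)) _ =>
      length_shiftedPiece hx hxm hr (s.1 : ℕ) n,
    Finset.sum_congr rfl fun (s : Σ p : TorsionIndex r, Fin (τ p.1.1 p.1.2)) _ =>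
      length_map_shiftedPiece hx hxm hr s.1.1.1 s.1.1.2 n] at hlen
  rw [relLength_eq_toNat, hlen]
  refine Eq.trans (congrArg ENat.toNat ?_) (ENat.toNat_natCast _)
  push_cast
  rfl

/-- Summing the Hilbert function over `n < r`, a free generator of degree `i` counts `r - i` times
and a torsion summand counts its full length `j`, its interval lying below `r`. In degree `r` only
the free part survives, so `H(r) = ∑ α i`. -/
theorem weightedSum_eq_of_decomposition (hx : x ∈ A⁰) (hxm : Ideal.span {x} ≤ maximalIdeal A)
    (hr : maximalIdeal A ^ (r + 1) = Ideal.span {x} * maximalIdeal A ^ r)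
    (he : ∀ (f : NoetherNormalization x) (g : Cone A), e (FiberCone.map hxm f * g) = f • e g)
    (hn : ∀ (n : ℕ) (g : Cone A), g ∈ piece (maximalIdeal A) n ↔
      IsHomogeneousOfDegree n (e g)) :
    weightedSum r (fun i => (α i : ℤ)) =
      relLength (maximalIdeal A ^ r) (Ideal.span {x ^ r}) +
        ((∑ s : Σ p : TorsionIndex r, Fin (τ p.1.1 p.1.2), s.1.1.2 : ℕ) : ℤ) := by
  have hw : weightedSum r (fun i => (α i : ℤ)) =
      ((∑ s : Σ i : Fin (r + 1), Fin (α i), (s.1 : ℕ) : ℕ) : ℤ) := by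
    rw [Fintype.sum_sigma, weightedSum_natCast]
    simp only [Finset.sum_const, Finset.card_univ, Fintype.card_fin, smul_eq_mul]
    rw [Fin.sum_univ_eq_sum_range (fun i => α i * i) (r + 1)]
  have h1 := relLength_pow_span_pow_add_sum hx (hxm (Ideal.mem_span_singleton_self x)) hr
  have hH := hilbert_eq_of_decomposition hx hxm hr he hn
  have h2 : ∑ n ∈ Finset.range r, relLength (maximalIdeal A ^ n) (maximalIdeal A ^ (n + 1)) =
      ∑ s : Σ i : Fin (r + 1), Fin (α i), (r - s.1 : ℕ) +
        ∑ s : Σ p : TorsionIndex r, Fin (τ p.1.1 p.1.2), s.1.1.2 := by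
    rw [Finset.sum_congr rfl fun n _ => hH n, Finset.sum_add_distrib]
    congr 1
    · rw [Finset.sum_comm]
      refine Finset.sum_congr rfl fun s _ => ?_
      rw [Finset.sum_boole, ← Nat.card_Ico, Nat.cast_id]
      congr 1
      ext n
      simp only [Finset.mem_filter, Finset.mem_range, Finset.mem_Ico]
      omega
    · rw [Finset.sum_comm]
      refine Finset.sum_congr rfl fun s _ => ?_
      have hs := s.1.2
      have : s.1.1.2 = (Finset.Ico s.1.1.1 (s.1.1.1 + s.1.1.2)).card := by
        rw [Nat.card_Ico, Nat.add_sub_cancel_left]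
      rw [Finset.sum_boole, Nat.cast_id]
      conv_rhs => rw [this]
      congr 1
      ext n
      simp only [Finset.mem_filter, Finset.mem_range, Finset.mem_Ico]
      omega
  have h3 : r * relLength (maximalIdeal A ^ r) (maximalIdeal A ^ (r + 1)) =
      ∑ s : Σ i : Fin (r + 1), Fin (α i), (r - s.1 : ℕ) +
        ∑ s : Σ i : Fin (r + 1), Fin (α i), (s.1 : ℕ) := by
    rw [hH, Finset.sum_eq_zero (s := (Finset.univ : Finset
      (Σ p : TorsionIndex r, Fin (τ p.1.1 p.1.2)))) fun s _ => if_neg (by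
        have := s.1.2; omega), add_zero, Finset.mul_sum, ← Finset.sum_add_distrib]
    refine Finset.sum_congr rfl fun s _ => ?_
    have := s.1.2
    rw [if_pos (by omega)]
    omega
  rw [hw]
  norm_cast
  omega

theorem eq_zero_of_xStar_mul_eq_zero (hx : x ∈ A⁰) (hxm : Ideal.span {x} ≤ maximalIdeal A)
    (hr : maximalIdeal A ^ (r + 1) = Ideal.span {x} * maximalIdeal A ^ r)
    {f : NoetherNormalization x} (h : xStar x * f = 0) : f = 0 := by
  refine eq_zero_of_proj fun n => ?_
  obtain ⟨a, ha⟩ := mem_piece_span_iff.mp (proj_mem n f)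
  have h1 := proj_mul_of_mem (xStar_mem_piece (x := x)) f (n + 1)
  rw [mul_comm, h, map_zero, if_pos (by omega), Nat.add_sub_cancel, ha, smul_mul_assoc,
    ← pow_succ, eq_comm, smul_xStar_pow_eq_zero_iff hx hxm hr] at h1
  rw [ha]
  exact smul_eq_zero_of_mem h1 _

/-- The initial form of `x` is regular if and only if a decomposition of the tangent cone has no
torsion. -/
theorem regular_iff_isEmpty_of_decomposition (hx : x ∈ A⁰)
    (hxm : Ideal.span {x} ≤ maximalIdeal A)
    (hr : maximalIdeal A ^ (r + 1) = Ideal.span {x} * maximalIdeal A ^ r)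
    (he : ∀ (f : NoetherNormalization x) (g : Cone A), e (FiberCone.map hxm f * g) = f • e g) :
    (∀ g : Cone A, FiberCone.map hxm (xStar x) * g = 0 → g = 0) ↔
      IsEmpty (Σ p : TorsionIndex r, Fin (τ p.1.1 p.1.2)) := by
  classical
  constructor
  · intro h
    refine ⟨fun s => ?_⟩
    have hj := s.1.2.2.1
    -- The socle of a torsion summand, the class of the `(j-1)`-st power of `x⋆`, is nonzero and
    -- killed by `x⋆`.
    let d : DecompositionModule x r α τ :=
      (0, Pi.single s (Ideal.Quotient.mk _ (xStar x ^ (s.1.1.2 - 1))))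
    have hd : xStar x • d = 0 := by
      refine Prod.ext (smul_zero _) (funext fun t => ?_)
      change xStar x • d.2 t = 0
      by_cases hts : t = s
      swap
      · rw [show d.2 t = 0 from Pi.single_eq_of_ne hts _, smul_zero]
      subst hts
      rw [show d.2 t = _ from Pi.single_eq_same _ _]
      change Ideal.Quotient.mk _ (xStar x * xStar x ^ (t.1.1.2 - 1)) = 0
      rw [← pow_succ', Nat.sub_add_cancel hj, Ideal.Quotient.eq_zero_iff_mem]
      exact Ideal.mem_span_singleton_self _
    have hg := h (e.symm d) (e.injective (by rw [he, e.apply_symm_apply, hd, map_zero]))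
    rw [EmbeddingLike.map_eq_zero_iff] at hg
    have h1 : Ideal.Quotient.mk (Ideal.span {xStar x ^ s.1.1.2}) (xStar x ^ (s.1.1.2 - 1)) = 0 :=
      (Pi.single_eq_same (M := fun t : Σ p : TorsionIndex r, Fin (τ p.1.1 p.1.2) =>
        NoetherNormalization x ⧸ Ideal.span {xStar x ^ t.1.1.2}) s _).symm.trans
        (congrFun (congrArg Prod.snd hg) s)
    have h2 := (smul_mk_xStar_pow_eq_zero_iff hx hxm hr (n := s.1.1.2 - 1) (j := s.1.1.2)
      (by omega) 1).mp (by rw [one_smul, h1])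
    exact (Ideal.ne_top_iff_one _).mp (maximalIdeal.isMaximal A).ne_top h2
  · intro hem g hg
    have h1 := he (xStar x) g
    rw [hg, map_zero] at h1
    rw [← EmbeddingLike.map_eq_zero_iff (f := e)]
    refine Prod.ext (funext fun s => ?_) (funext fun s => hem.elim s)
    exact eq_zero_of_xStar_mul_eq_zero hx hxm hr (congrFun (congrArg Prod.fst h1.symm) s)

end Length

/-! ### Regularity of `x` and assembly. -/

section Main

variable {A : Type u} [CommRing A] [IsLocalRing A]

/-- Depth one provides a regular `a` in the maximal ideal; `x` divides the regular element `a ^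
(r+1)`, hence is regular. -/
theorem mem_nonZeroDivisors_of_isReduction (hA : IsCohenMacaulayLocalRing A)
    (hdim : ringKrullDim A = 1) {x : A} {r : ℕ}
    (hr : maximalIdeal A ^ (r + 1) = Ideal.span {x} * maximalIdeal A ^ r) : x ∈ A⁰ := by
  obtain ⟨-, rs, hrs, hreg, hlen⟩ := hA
  cases rs with
  | nil =>
    rw [hdim] at hlen
    simp at hlen
  | cons a rs =>
    have ha : IsSMulRegular A a := ((RingTheory.Sequence.isRegular_cons_iff A a rs).mp hreg).1
    have h1 : a ^ (r + 1) ∈ Ideal.span {x} :=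
      maximalIdeal_pow_le_span hr (Ideal.pow_mem_pow (hrs a (by simp)) _)
    obtain ⟨b, hb⟩ := Ideal.mem_span_singleton'.mp h1
    rw [mem_nonZeroDivisors_iff_right]
    intro y hy
    refine (ha.pow (r + 1)).right_eq_zero_of_smul ?_
    rw [smul_eq_mul, ← hb, mul_assoc, mul_comm x, hy, mul_zero]

theorem pow_reductionNumber_succ {A : Type u} [CommRing A] {I J : Ideal A} (h : IsReduction J I) :
    I ^ (reductionNumber J I + 1) = J * I ^ reductionNumber J I :=
  Nat.sInf_mem (s := {n : ℕ | I ^ (n + 1) = J * I ^ n}) h.2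

end Main

end TangentCone

end

theorem mainTheorem4 {A : Type*} [CommRing A] [IsLocalRing A]
    (hA : TangentCone.IsCohenMacaulayLocalRing A) (hdim : ringKrullDim A = 1)
    (hinf : Infinite (IsLocalRing.ResidueField A)) (x : A)
    (hx : TangentCone.IsMinimalReduction (Ideal.span {x}) (IsLocalRing.maximalIdeal A))
    (r : ℕ)
    (hr : r = TangentCone.reductionNumber (Ideal.span {x}) (IsLocalRing.maximalIdeal A)) :
    (∃ (α : ℕ → ℕ) (τ : ℕ → ℕ → ℕ), TangentCone.IsTangentConeInvariants x hx.prop.1 α τ) ∧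
    ∀ (α : ℕ → ℕ) (τ : ℕ → ℕ → ℕ), TangentCone.IsTangentConeInvariants x hx.prop.1 α τ →
      (TangentCone.weightedSum r (fun i => (TangentCone.aperyInvariant x i : ℤ)) ≤
          TangentCone.weightedSum r (fun i => TangentCone.microInvariant A i) ∧
        TangentCone.weightedSum r (fun i => TangentCone.microInvariant A i) ≤
          TangentCone.weightedSum r (fun i => (α i : ℤ))) ∧
      (TangentCone.weightedSum r (fun i => (TangentCone.aperyInvariant x i : ℤ)) =
          TangentCone.weightedSum r (fun i => TangentCone.microInvariant A i) ↔
        TangentCone.IsCohenMacaulayRing (TangentCone.Cone A)) ∧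
      (TangentCone.weightedSum r (fun i => TangentCone.microInvariant A i) =
          TangentCone.weightedSum r (fun i => (α i : ℤ)) ↔
        TangentCone.IsCohenMacaulayRing (TangentCone.Cone A)) ∧
      (TangentCone.weightedSum r (fun i => (TangentCone.aperyInvariant x i : ℤ)) =
          TangentCone.weightedSum r (fun i => (α i : ℤ)) ↔
        TangentCone.IsCohenMacaulayRing (TangentCone.Cone A)) := by
  have hnoeth : IsNoetherianRing A := hA.1
  subst hr
  have hxm : Ideal.span {x} ≤ IsLocalRing.maximalIdeal A := hx.prop.1
  have hxmem : x ∈ IsLocalRing.maximalIdeal A := hxm (Ideal.mem_span_singleton_self x)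
  have hr := TangentCone.pow_reductionNumber_succ hx.prop
  have hreg := TangentCone.mem_nonZeroDivisors_of_isReduction hA hdim hr
  refine ⟨TangentCone.exists_decomposition hreg hxm hr, ?_⟩
  rintro α τ ⟨e, he, hn⟩
  have hβ := TangentCone.weightedSum_microInvariant hreg hxmem hr
  have hα := TangentCone.weightedSum_eq_of_decomposition hreg hxm hr he hn
  have hγ := TangentCone.weightedSum_aperyInvariant_le hreg hxmem hr
  have hγCM := (TangentCone.weightedSum_aperyInvariant_eq_iff hreg hxmem hr).trans
    ((TangentCone.isRegular_xStar_iff hreg hxm).symm.trans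
      (TangentCone.FiberCone.isCohenMacaulayRing_iff hreg hxm hr).symm)
  have hαCM := ((TangentCone.FiberCone.isCohenMacaulayRing_iff hreg hxm hr).trans
    (TangentCone.regular_iff_isEmpty_of_decomposition hreg hxm hr he)).symm
  rw [← hβ] at hα hγ hγCM
  -- Every torsion summand has length `j ≥ 1`, so the total torsion length vanishes only if there is
  -- no torsion summand.
  have hzero : ∑ s : Σ p : TangentCone.TorsionIndex
      (TangentCone.reductionNumber (Ideal.span {x}) (IsLocalRing.maximalIdeal A)),
      Fin (τ p.1.1 p.1.2), s.1.1.2 = 0 ↔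
      TangentCone.IsCohenMacaulayRing (TangentCone.Cone A) := by
    rw [← hαCM, Finset.sum_eq_zero_iff, ← not_nonempty_iff]
    constructor
    · rintro h ⟨s⟩
      have h1 := h s (Finset.mem_univ s)
      have h2 := s.1.2.2.1
      omega
    · intro h s
      exact absurd ⟨s⟩ h
  have hβα := hzero
  refine ⟨⟨hγ, by omega⟩, hγCM, ?_, ?_⟩
  · rw [← hzero]
    omega
  -- The outer equality squeezes the middle sum, so the excess of `∑ i α i` over `∑ i β i`, which is
  -- the torsion length, is zero.
  · constructor
    · intro h
      exact hzero.mp (by omega)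
    · intro h
      have h1 := hγCM.mpr h
      have h2 := hzero.mpr h
      omega
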